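/- **Setting.** Let $\mathcal A$ be a finite alphabet and let $T\colon[0,1)\to[0,1)$ be an interval exchange map (i.e.m.): a bijection for which $[0,1)$ is partitioned into nonempty intervals $I_a=[l_a,r_a)$, $a\in\mathcal A$, with $T(t)=t+\delta_a$ on $I_a$. Assume that $T$ is self-similar on $[0,\alpha)$, $0<\alpha<1$: the first return map of $T$ to $[0,\alpha)$ sends $\alpha t$ to $\alpha T(t)$ for all $t\in[0,1)$. Let $\sigma$ be the associated substitution: $\sigma(a)=w_0\dots w_{n-1}$, where $n$ is the (common) first return time of the points of $\alpha I_a$ to $[0,\alpha)$ and $T^m(\alpha I_a)\subseteq I_{w_m}$ for $0\le m<n$. Let $M$ be its matrix, $M_{a,b}$ being the number of occurrences of $b$ in $\sigma(a)$. Let $\beta\in\mathbb C$ be an eigenvalue of $M$ with $|\beta|>1$ such that $\beta_0=\beta/|\beta|$ is not a root of unity, and let $\Gamma\in\mathbb C^{\mathcal A}$ be an eigenvector, $M\Gamma=\beta\Gamma$. For a word $w$ let $\Gamma(w)$ be the sum of $\Gamma_c$ over the letters $c$ of $w$. Let $\bar{\mathcal A}_a$ be the set of triples $(p,c,s)$ of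 a word, a letter and a word with $\sigma(a)=pcs$, and let $\bar{\mathcal A}=\bigcup_a\bar{\mathcal A}_a$ (the labels). Let $S_a$ be the set of sequences $x=(p_m,c_m,s_m)_{m\ge1}$ of labels with $(p_1,c_1,s_1)\in\bar{\mathcal A}_a$ and $(p_{m+1},c_{m+1},s_{m+1})\in\bar{\mathcal A}_{c_m}$ for $m\ge1$. Put $z(x)=\sum_{m\ge1}\beta^{-m}\Gamma(p_m)$, $F_a=z(S_a)$, and $F_{a,(p,c,s)}=z(\{x\in S_a: x_1=(p,c,s)\})$ for $(p,c,s)\in\bar{\mathcal A}_a$. For $\tau\in S^1$ put $v_a(\tau)=\min_{z\in F_a}\Re(\tau z)$ and $v_{a,(p,c,s)}(\tau)=\min_{z\in F_{a,(p,c,s)}}\Re(\tau z)$. A point $z\in F_a$ is extreme if $v_a(\tau)=\Re(\tau z)$ for some $\tau\in S^1$. Assume the unique representation property: for every $a$ and every extreme point $z$ of $F_a$ there is exactly one $x\in S_a$ with $z(x)=z$. **The map $H$.** Let $X=S^1\times\bar{\mathcal A}$. The skew product $H\colon X\to X$ is given by $H(\tau,(q,a,r))=(\beta_0^{-1}\tau,(p,c,s))$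 with $(p,c,s)\in\bar{\mathcal A}_a$ and $v_{a,(p,c,s)}(\tau)=v_a(\tau)$, the choice of $(p,c,s)$ being such that $H$ is right-continuous (for the counterclockwise orientation of $S^1$ and the discrete topology on $\bar{\mathcal A}$). **Minimal components.** Number the labels $0,\dots,N-1$, and identify $X$ with $[0,1)$ by sending $(e^{2\pi i\theta},b)$, $\theta\in[0,1)$, to $(k+\theta)/N$, where $k$ is the number of $b$; thus $H$ becomes a right-continuous piecewise translation $f$ of $[0,1)$ into itself. Let $\tilde f(t)=\lim_{s\nearrow t}f(s)$ for $t\in(0,1]$, and let $D\subseteq(0,1]$ be the set of all points whose forward $\tilde f$-orbit meets the forward $\tilde f$-orbit of $1$ or of a discontinuity of $f$ in $(0,1)$. Let $\hat I=[0,1)\cup\{t^-:t\in D\}$, with $t^-$ placed immediately to the left of $t$, carry the order topology, and put $\hat f(t)=f(t)$ and $\hat f(t^-)=\tilde f(t)^-$. A minimal component of $H$ is a set of the form $\hat J\cap[0,1)$ (viewed in $X$), where $\hat J\subseteq\hat I$ is nonempty and closed, $\hat f(\hat J)=\hat J$, and the forward $\hat f$-orbit of every point of $\hat J$ is dense in $\hat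 J$. **Theorem.** There is exactly one such map $H$. For every numbering of the labels, $H$ has finitely many minimal components, and at least one, and the restriction of $H$ to each of them is an i.e.m.: seen in $[0,1)$, the component $J$ is partitioned into finitely many nonempty intervals $[u_i,v_i)$ on each of which $f$ is a translation, and $f$ maps $J$ bijectively onto $J$. -/

import Mathlib

open Set Filter Topology

namespace SelfSimilarIEM

noncomputable section

/-! ### Interval exchange maps -/

/-- `T` restricts to an interval exchange map of `J`: the set `J` is partitioned into the finitely
many nonempty intervals `[l a, r a)`, the map `T` is the translation by `δ a` on `[l a, r a)`, and
`T` is a bijection of `J`. -/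
structure IsIEM {ι : Type*} [Finite ι] (T : ℝ → ℝ) (J : Set ℝ) (l r δ : ι → ℝ) : Prop where
  lt : ∀ a, l a < r a
  disjoint : Pairwise fun a b => Disjoint (Ico (l a) (r a)) (Ico (l b) (r b))
  cover : ⋃ a, Ico (l a) (r a) = J
  translation : ∀ a, ∀ t ∈ Ico (l a) (r a), T t = t + δ a
  bijOn : BijOn T J J

/-- `n` is the time of first return of the point `t` to the set `S` under `T`. -/
def IsFirstReturnTime (T : ℝ → ℝ) (S : Set ℝ) (t : ℝ) (n : ℕ) : Prop :=
  0 < n ∧ T^[n] t ∈ S ∧ ∀ m, 0 < m → m < n → T^[m] t ∉ S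

/-- `T` is self-similar on `[0, α)`, where `0 < α < 1`: the first return map of `T` to `[0, α)`
is `T` rescaled, that is, it sends `α * t` to `α * T t` for every `t ∈ [0, 1)`. -/
def IsSelfSimilarOn (T : ℝ → ℝ) (α : ℝ) : Prop :=
  0 < α ∧ α < 1 ∧ ∀ t ∈ Ico (0 : ℝ) 1,
    ∃ n, IsFirstReturnTime T (Ico 0 α) (α * t) n ∧ T^[n] (α * t) = α * T t

/-- `σ` is the substitution associated with the self-similar map `T`: the word `σ a` has length
the common first return time to `[0, α)` of the points of `α [l a, r a)`, and its letter of
index `m` is the `b` with `T^m (α [l a, r a)) ⊆ [l b, r b)`. -/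
def IsAssociatedSubstitution {𝒜 : Type*} (T : ℝ → ℝ) (l r : 𝒜 → ℝ) (α : ℝ) (σ : 𝒜 → List 𝒜) :
    Prop :=
  ∀ a, ∀ t ∈ Ico (l a) (r a),
    IsFirstReturnTime T (Ico 0 α) (α * t) (σ a).length ∧
    ∀ (m : ℕ) (hm : m < (σ a).length), T^[m] (α * t) ∈ Ico (l (σ a)[m]) (r (σ a)[m])

/-! ### Substitutions, labels and fractals -/

variable {𝒜 : Type*}

/-- The matrix of a substitution: the entry `(a, b)` is the number of occurrences of the letter
`b` in the word `σ a`. -/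
def substMatrix [DecidableEq 𝒜] (σ : 𝒜 → List 𝒜) : Matrix 𝒜 𝒜 ℂ :=
  Matrix.of fun a b => ((σ a).count b : ℂ)

/-- The value `γ(w)`, the sum of the `γ c` over the letters `c` of the word `w`. -/
def wordValue (γ : 𝒜 → ℂ) (w : List 𝒜) : ℂ := (w.map γ).sum

/-- The labels of `σ`: triples `(p, c, s)` with `σ a = p c s` for some letter `a`. -/
def Label (σ : 𝒜 → List 𝒜) : Type _ :=
  {x : List 𝒜 × 𝒜 × List 𝒜 // ∃ a, σ a = x.1 ++ x.2.1 :: x.2.2}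

namespace Label

variable {σ : 𝒜 → List 𝒜}

/-- The prefix `p` of the label `(p, c, s)`. -/
def pre (x : Label σ) : List 𝒜 := x.1.1

/-- The central letter `c` of the label `(p, c, s)`. -/
def center (x : Label σ) : 𝒜 := x.1.2.1

/-- The suffix `s` of the label `(p, c, s)`. -/
def suf (x : Label σ) : List 𝒜 := x.1.2.2

/-- The label `(p, c, s)` is a label of the letter `a`, that is, `σ a = p c s`. -/
def IsLabelOf (x : Label σ) (a : 𝒜) : Prop := σ a = x.pre ++ x.center :: x.suf

end Label

instance [Finite 𝒜] (σ : 𝒜 → List 𝒜) : Finite (Label σ) := by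
  let f : Label σ → Σ a : 𝒜, Fin ((σ a).length + 1) := fun x =>
    ⟨x.2.choose, ⟨x.pre.length, by
      have h := congrArg List.length x.2.choose_spec
      simp only [List.length_append, List.length_cons] at h
      have h' : x.pre.length = x.1.1.length := rfl
      omega⟩⟩
  refine Finite.of_injective f fun x y h => ?_
  have hx := x.2.choose_spec
  have hy := y.2.choose_spec
  have h1 : x.2.choose = y.2.choose := congrArg Sigma.fst h
  have h2 : x.1.1.length = y.1.1.length :=
    congrArg (fun z : Σ a : 𝒜, Fin ((σ a).length + 1) => (z.2 : ℕ)) h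
  rw [← h1, hx] at hy
  obtain ⟨e1, e2⟩ := List.append_inj hy h2
  simp only [List.cons.injEq] at e2
  exact Subtype.ext (Prod.ext e1 (Prod.ext e2.1 e2.2))

/-- The sequences of labels `(p_m, c_m, s_m)` (the first one has index `0` here) such that the
first one is a label of `a` and each other one is a label of the central letter of the
preceding one. -/
def seqs (σ : 𝒜 → List 𝒜) (a : 𝒜) : Set (ℕ → Label σ) :=
  {x | (x 0).IsLabelOf a ∧ ∀ m, (x (m + 1)).IsLabelOf (x m).center}

/-- The sequences in `seqs σ a` whose first label is `b`. -/
def seqsFrom (σ : 𝒜 → List 𝒜) (a : 𝒜) (b : Label σ) : Set (ℕ → Label σ) :=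
  {x | x ∈ seqs σ a ∧ x 0 = b}

/-- The complex number represented by a sequence of labels: the sum of the absolutely convergent
series of the `β ^ (-m) * γ(p_m)`, `m ≥ 1`. -/
def seqPoint {σ : 𝒜 → List 𝒜} (β : ℂ) (γ : 𝒜 → ℂ) (x : ℕ → Label σ) : ℂ :=
  ∑' m : ℕ, (β ^ (m + 1))⁻¹ * wordValue γ (x m).pre

/-- The fractal of the letter `a`. -/
def fractal (σ : 𝒜 → List 𝒜) (β : ℂ) (γ : 𝒜 → ℂ) (a : 𝒜) : Set ℂ :=
  seqPoint β γ '' seqs σ a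

/-- The sub-fractal of the letter `a` and the label `b`. -/
def subfractal (σ : 𝒜 → List 𝒜) (β : ℂ) (γ : 𝒜 → ℂ) (a : 𝒜) (b : Label σ) : Set ℂ :=
  seqPoint β γ '' seqsFrom σ a b

/-- The support function of a set `F` of complex numbers: the minimum (for compact `F ≠ ∅`, as
the fractals are) of `Re (τ z)` over `z ∈ F`. -/
def support (F : Set ℂ) (τ : Circle) : ℝ := sInf ((fun z : ℂ => ((τ : ℂ) * z).re) '' F)

/-- The point `z` of `F` is an extreme point of `F` (for some direction). -/
def IsExtremePt (F : Set ℂ) (z : ℂ) : Prop :=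
  z ∈ F ∧ ∃ τ : Circle, support F τ = ((τ : ℂ) * z).re

/-- The unique representation property: every extreme point of every fractal is represented
by exactly one sequence. -/
def UniqueRepresentation (σ : 𝒜 → List 𝒜) (β : ℂ) (γ : 𝒜 → ℂ) : Prop :=
  ∀ a, ∀ z, IsExtremePt (fractal σ β γ a) z → ∃! x, x ∈ seqs σ a ∧ seqPoint β γ x = z

/-! ### The skew product -/

/-- `H` is the skew product on the product of the unit circle and the set of labels:
`H (τ, (q, a, r)) = (β₀⁻¹ τ, (p, c, s))`, where `β₀ = β / |β|` and `(p, c, s)` is a label of `a`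
whose sub-fractal attains the support function of the fractal of `a` in the direction `τ`. In the
directions in which several labels do so, the choice is made so that `H` is continuous from the
right (the labels being discrete, the label of the image is locally constant from the right,
for the counterclockwise orientation of the circle). -/
structure IsSkewProduct (σ : 𝒜 → List 𝒜) (β : ℂ) (γ : 𝒜 → ℂ)
    (H : Circle × Label σ → Circle × Label σ) : Prop where
  rotation : ∀ τ b, ((H (τ, b)).1 : ℂ) = (β / (‖β‖ : ℂ))⁻¹ * (τ : ℂ)
  isLabelOf : ∀ τ b, (H (τ, b)).2.IsLabelOf b.center
  attains : ∀ τ b, support (fractal σ β γ b.center) τ =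
    support (subfractal σ β γ b.center (H (τ, b)).2) τ
  rightContinuous : ∀ τ b, ∀ᶠ θ in 𝓝[>] (0 : ℝ), (H (τ * Circle.exp θ, b)).2 = (H (τ, b)).2

/-- The identification of the product of the circle and the set of `N` labels with `[0, 1)`:
the circle of the label numbered `k` is sent to `[k / N, (k + 1) / N)`, linearly and preserving
the orientation, the point `1` of the circle being sent to `k / N`. -/
def toInterval {σ : 𝒜 → List 𝒜} {N : ℕ} (e : Label σ ≃ Fin N) (x : Circle × Label σ) : ℝ :=
  (((e x.2 : ℕ) : ℝ) + Int.fract (Complex.arg (x.1 : ℂ) / (2 * Real.pi))) / N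

/-- The map of the interval `[0, 1)` that corresponds to `H` under `toInterval e`
(its values outside `[0, 1)` are irrelevant). -/
def intervalMap {σ : 𝒜 → List 𝒜} {N : ℕ} (e : Label σ ≃ Fin N)
    (H : Circle × Label σ → Circle × Label σ) : ℝ → ℝ :=
  Function.extend (toInterval e) (fun x => toInterval e (H x)) id

/-! ### Minimal components of piecewise translations of `[0, 1)`

Below, `f` is a right-continuous piecewise translation of `[0, 1)` into itself, with finitely many
pieces. Its left-continuous version `t ↦ f(t⁻)` is then a map of `(0, 1]` into itself. -/

/-- The points of `(0, 1]` that are doubled: the discontinuities of `f` and the end point `1`,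
with all their images and preimages under the left-continuous version of `f`, that is, all the
points of `(0, 1]` whose forward orbit meets that of a discontinuity or of `1`. -/
def doubledPoints (f : ℝ → ℝ) : Set ℝ :=
  {t | t ∈ Ioc (0 : ℝ) 1 ∧ ∃ d, (d = 1 ∨ (d ∈ Ioo (0 : ℝ) 1 ∧ ¬ ContinuousAt f d)) ∧
    ∃ m n : ℕ, (Function.leftLim f)^[m] t = (Function.leftLim f)^[n] d}

/-- The interval with the doubled points split in two: `(t, true)` is the point `t ∈ [0, 1)`,
and `(t, false)` is the point `t⁻` immediately to its left, for doubled `t`. (The point `1⁻` is the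
right end point added to `[0, 1)`.) -/
def SplitInterval (f : ℝ → ℝ) : Type :=
  {x : ℝ ×ₗ Bool // ((ofLex x).2 = true ∧ (ofLex x).1 ∈ Ico (0 : ℝ) 1) ∨
    ((ofLex x).2 = false ∧ (ofLex x).1 ∈ doubledPoints f)}

instance (f : ℝ → ℝ) : LinearOrder (SplitInterval f) :=
  inferInstanceAs (LinearOrder (Subtype _))

/-- The split interval carries the topology of its order. -/
instance (f : ℝ → ℝ) : TopologicalSpace (SplitInterval f) := Preorder.topology _

/-- The extension of `f` to the split interval, on the underlying pairs: `t` is sent to `f t` and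
`t⁻` is sent to `(f(t⁻))⁻`. -/
def splitMap (f : ℝ → ℝ) (x : ℝ ×ₗ Bool) : ℝ ×ₗ Bool :=
  if (ofLex x).2 = true then toLex (f (ofLex x).1, true)
  else toLex (Function.leftLim f (ofLex x).1, false)

/-- A minimal component of the extension of `f` to the split interval: a nonempty closed set that
is mapped onto itself and in which every orbit is dense. -/
def IsSplitMinimalComponent (f : ℝ → ℝ) (K : Set (SplitInterval f)) : Prop :=
  K.Nonempty ∧ IsClosed K ∧
  splitMap f '' (Subtype.val '' K) = Subtype.val '' K ∧
  ∀ x ∈ K, K ⊆ closure {y : SplitInterval f | ∃ n : ℕ, y.val = (splitMap f)^[n] x.val}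

/-- A minimal component of `f`: the trace on `[0, 1)` of a minimal component of the extension of
`f` to the split interval. -/
def IsMinimalComponentOn (f : ℝ → ℝ) (J : Set ℝ) : Prop :=
  ∃ K : Set (SplitInterval f), IsSplitMinimalComponent f K ∧
    J = {t | ∃ x ∈ K, x.val = toLex (t, true)}

/-- A minimal component of the skew product `H`: a set that corresponds under `toInterval e` to
a minimal component of the map of `[0, 1)` induced by `H`. -/
def IsMinimalComponent {σ : 𝒜 → List 𝒜} {N : ℕ} (e : Label σ ≃ Fin N)
    (H : Circle × Label σ → Circle × Label σ) (K : Set (Circle × Label σ)) : Prop :=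
  IsMinimalComponentOn (intervalMap e H) (toInterval e '' K)

end

end SelfSimilarIEM

namespace SelfSimilarIEM

noncomputable section

/-! ### Labels, fractals and skew products -/

section Fractals

variable {𝒜 : Type*} {σ : 𝒜 → List 𝒜} {β : ℂ} {Γ : 𝒜 → ℂ}

/-! Fix a direction `τ` and one side of it. Among the minimizers of `Re (τ z)` on a fractal, take
the one farthest along the face on the side favoured when `τ` is turned that way. If a label wins in
directions accumulating at `τ` from that side, its minimizers there accumulate at this point, so its
compact sub-fractal contains it (`last_minimizer_mem`). The point is extreme, hence has a single
representation and a single first label: near `τ`, on each side, exactly one label wins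
(`exists_eventually_wins_iff`). The right-hand winner determines `H`. The left-hand winner gives
left germs, so the interval map `f` is a translation on each side of every point, and it lies over
an irrational rotation (`IsSkewProduct.isRotationExtension`).

Let `J` be the trace of a minimal set. Its fibres over the circle are finite, `f` maps each fibre
onto the next, and right-closedness prevents the cardinality from growing just to the right of a
point. Starting beside a fibre of least cardinality and following the dense rotation shows that all
fibres have the same cardinality (`ncard_fibre_eq`). Hence `f` is injective on `J`, and fibres move
by translation to the right of each point; an iterate of `f` transports this structure to the left
of any point (`eventually_sub_mem_iff`). Compactness of `[0, 1]` then yields finitely many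
intervals.

The split interval is compact and the extension of `f` to it is continuous, so minimal sets exist by
Zorn's lemma; density of the rotation prevents their traces from being empty (`trace_nonempty`).
Components with a common point coincide and each one meets the finite fibre over `0`, so there are
finitely many. -/

theorem Label.exists_isLabelOf (hne : ∀ a, σ a ≠ []) (a : 𝒜) : ∃ b : Label σ, b.IsLabelOf a := by
  obtain ⟨c, s, h⟩ := List.exists_cons_of_ne_nil (hne a)
  exact ⟨⟨([], c, s), a, by simpa using h⟩, by
    simpa [Label.IsLabelOf, Label.pre, Label.center, Label.suf] using h⟩

theorem seqsFrom_nonempty (hne : ∀ a, σ a ≠ []) {a : 𝒜} {b : Label σ} (hb : b.IsLabelOf a) :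
    (seqsFrom σ a b).Nonempty := by
  choose g hg using Label.exists_isLabelOf hne
  let x : ℕ → Label σ := fun n => Nat.rec b (fun _ y => g y.center) n
  exact ⟨x, ⟨hb, fun m => hg _⟩, rfl⟩

theorem subfractal_subset (a : 𝒜) (b : Label σ) : subfractal σ β Γ a b ⊆ fractal σ β Γ a :=
  image_mono fun _ h => h.1

theorem subfractal_nonempty (hne : ∀ a, σ a ≠ []) {a : 𝒜} {b : Label σ} (hb : b.IsLabelOf a) :
    (subfractal σ β Γ a b).Nonempty :=
  (seqsFrom_nonempty hne hb).image _

theorem exists_mem_subfractal {a : 𝒜} {z : ℂ} (hz : z ∈ fractal σ β Γ a) :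
    ∃ b : Label σ, b.IsLabelOf a ∧ z ∈ subfractal σ β Γ a b := by
  obtain ⟨x, hx, rfl⟩ := hz
  exact ⟨x 0, hx.1, x, ⟨hx, rfl⟩, rfl⟩

theorem UniqueRepresentation.label_unique (hurp : UniqueRepresentation σ β Γ) {a : 𝒜} {z : ℂ}
    (hz : IsExtremePt (fractal σ β Γ a) z) {b b' : Label σ} (hb : z ∈ subfractal σ β Γ a b)
    (hb' : z ∈ subfractal σ β Γ a b') : b = b' := by
  obtain ⟨x, hx, hxz⟩ := hb
  obtain ⟨y, hy, hyz⟩ := hb'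
  have h := (hurp a z hz).unique ⟨hx.1, hxz⟩ ⟨hy.1, hyz⟩
  rw [← hx.2, ← hy.2, h]

/-- The label `b` of `a` attains the support function of the fractal of `a` in the direction
`τ`. -/
def Wins (σ : 𝒜 → List 𝒜) (β : ℂ) (Γ : 𝒜 → ℂ) (a : 𝒜) (b : Label σ) (τ : Circle) : Prop :=
  b.IsLabelOf a ∧ support (fractal σ β Γ a) τ = support (subfractal σ β Γ a b) τ

/-- The factor `(β / |β|)⁻¹` of the rotation is a point of the circle. -/
theorem exists_circle_eq (hβ : 1 < ‖β‖) : ∃ ρ : Circle, (ρ : ℂ) = (β / (‖β‖ : ℂ))⁻¹ := by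
  have hβ0 : ‖β‖ ≠ 0 := by linarith
  have h : ‖(β / (‖β‖ : ℂ))⁻¹‖ = 1 := by
    rw [norm_inv, norm_div, Complex.norm_real, norm_norm, div_self hβ0, inv_one]
  exact ⟨⟨_, mem_sphere_zero_iff_norm.2 h⟩, rfl⟩

theorem isSkewProduct_iff {ρ : Circle} (hρ : (ρ : ℂ) = (β / (‖β‖ : ℂ))⁻¹)
    (H : Circle × Label σ → Circle × Label σ) : IsSkewProduct σ β Γ H ↔
      ∀ τ b, (H (τ, b)).1 = ρ * τ ∧ Wins σ β Γ b.center (H (τ, b)).2 τ ∧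
        ∀ᶠ θ in 𝓝[>] (0 : ℝ), (H (τ * Circle.exp θ, b)).2 = (H (τ, b)).2 := by
  constructor
  · intro h τ b
    refine ⟨Circle.ext ?_, ⟨h.isLabelOf τ b, h.attains τ b⟩, h.rightContinuous τ b⟩
    rw [h.rotation, Circle.coe_mul, hρ]
  · intro h
    exact ⟨fun τ b => by rw [(h τ b).1, Circle.coe_mul, hρ], fun τ b => (h τ b).2.1.1,
      fun τ b => (h τ b).2.1.2, fun τ b => (h τ b).2.2⟩

/-! ### Compactness of the fractals -/

variable [Finite 𝒜]

theorem exists_norm_wordValue_le (σ : 𝒜 → List 𝒜) (Γ : 𝒜 → ℂ) :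
    ∃ C : ℝ, ∀ b : Label σ, ‖wordValue Γ b.pre‖ ≤ C := by
  obtain ⟨C, hC⟩ := (Set.finite_range fun b : Label σ => ‖wordValue Γ b.pre‖).bddAbove
  exact ⟨C, fun b => hC ⟨b, rfl⟩⟩

/-- With discrete labels, the sequence space is a product of finite spaces, hence compact;
admissibility is a closed condition, and the series converges uniformly because `|β| > 1` and the
prefix values are bounded. The predicate `p` covers fractals and sub-fractals at once. -/
theorem isCompact_seqPoint_image (hβ : 1 < ‖β‖) (a : 𝒜) (p : Label σ → Prop) :
    IsCompact (seqPoint β Γ '' {x | x ∈ seqs σ a ∧ p (x 0)}) := by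
  let _ : TopologicalSpace (Label σ) := ⊥
  have _ : DiscreteTopology (Label σ) := ⟨rfl⟩
  have hcont : Continuous (seqPoint (σ := σ) β Γ) := by
    obtain ⟨C, hC⟩ := exists_norm_wordValue_le σ Γ
    have hs : Summable fun m : ℕ => (‖β‖⁻¹) ^ (m + 1) * C :=
      (((summable_geometric_of_lt_one (by positivity) (inv_lt_one_of_one_lt₀ hβ)).comp_injective
        (add_left_injective 1)).mul_right C)
    refine continuous_tsum (fun m => ?_) hs fun m x => ?_
    · exact continuous_const.mul
        ((continuous_of_discreteTopology (f := fun b : Label σ => wordValue Γ b.pre)).comp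
          (continuous_apply m))
    · rw [norm_mul, norm_inv, norm_pow, inv_pow]
      exact mul_le_mul_of_nonneg_left (hC _) (by positivity)
  refine IsCompact.image (IsClosed.isCompact ?_) hcont
  have h : {x : ℕ → Label σ | x ∈ seqs σ a ∧ p (x 0)} =
      (⋂ m, (fun x : ℕ → Label σ => (x (m + 1), x m)) ⁻¹' {y | y.1.IsLabelOf y.2.center}) ∩
      (fun x : ℕ → Label σ => x 0) ⁻¹' {b | b.IsLabelOf a ∧ p b} := by
    ext x
    simp only [seqs, mem_ofPred_eq, mem_inter_iff, mem_iInter, mem_preimage]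
    tauto
  rw [h]
  exact (isClosed_iInter fun m => (isClosed_discrete _).preimage (by fun_prop)).inter
    ((isClosed_discrete _).preimage (by fun_prop))

theorem isCompact_fractal (hβ : 1 < ‖β‖) (a : 𝒜) : IsCompact (fractal σ β Γ a) := by
  simpa [fractal] using isCompact_seqPoint_image (Γ := Γ) hβ a (fun _ : Label σ => True)

theorem isCompact_subfractal (hβ : 1 < ‖β‖) (a : 𝒜) (b : Label σ) :
    IsCompact (subfractal σ β Γ a b) :=
  isCompact_seqPoint_image hβ a (· = b)

/-! ### Support functions -/

theorem support_le {F : Set ℂ} (hF : IsCompact F) {τ : Circle} {z : ℂ} (hz : z ∈ F) :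
    support F τ ≤ ((τ : ℂ) * z).re :=
  csInf_le (hF.image (f := fun z : ℂ => ((τ : ℂ) * z).re) (by fun_prop)).bddBelow ⟨z, hz, rfl⟩

theorem exists_support_eq {F : Set ℂ} (hF : IsCompact F) (hne : F.Nonempty) (τ : Circle) :
    ∃ z ∈ F, support F τ = ((τ : ℂ) * z).re := by
  obtain ⟨z, hz, h⟩ := (hF.image (f := fun z : ℂ => ((τ : ℂ) * z).re) (by fun_prop)).sInf_mem
    (hne.image _)
  exact ⟨z, hz, h.symm⟩

/-- In the direction `τ`, the compact set `F` has an extreme point which is the last one on its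
face, on the side indicated by the sign of `s`. -/
theorem exists_last_minimizer {F : Set ℂ} (hF : IsCompact F) (hne : F.Nonempty) (τ : Circle)
    (s : ℝ) : ∃ z ∈ F, support F τ = ((τ : ℂ) * z).re ∧
      ∀ w ∈ F, support F τ = ((τ : ℂ) * w).re → s * ((τ : ℂ) * w).im ≤ s * ((τ : ℂ) * z).im := by
  obtain ⟨z₀, hz₀, h₀⟩ := exists_support_eq hF hne τ
  have hc : IsCompact (F ∩ {w | support F τ = ((τ : ℂ) * w).re}) :=
    hF.inter_right (isClosed_eq continuous_const (by fun_prop))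
  obtain ⟨z, hz, h⟩ := hc.exists_isMaxOn ⟨z₀, hz₀, h₀⟩
    (f := fun w => s * ((τ : ℂ) * w).im) (by fun_prop)
  exact ⟨z, hz.1, hz.2, fun w hw hw' => h ⟨hw, hw'⟩⟩

theorem re_mul_exp (τ : Circle) (θ : ℝ) (z : ℂ) : (((τ * Circle.exp θ : Circle) : ℂ) * z).re =
    Real.cos θ * ((τ : ℂ) * z).re - Real.sin θ * ((τ : ℂ) * z).im := by
  have h : ((τ * Circle.exp θ : Circle) : ℂ) * z = Complex.exp (θ * Complex.I) * ((τ : ℂ) * z) := by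
    rw [Circle.coe_mul, Circle.coe_exp]; ring
  rw [h, Complex.mul_re, Complex.exp_ofReal_mul_I_re, Complex.exp_ofReal_mul_I_im]

/-- If a compact subset of `F` attains the support function of `F` in directions arbitrarily close
to `τ` on one side of `τ`, then it contains the last minimizer on that side. -/
theorem last_minimizer_mem {F F' : Set ℂ} (hF : IsCompact F) (hF' : IsCompact F') (hsub : F' ⊆ F)
    {τ : Circle} {s : ℝ} (hs : s = 1 ∨ s = -1) {z : ℂ} (hz : z ∈ F)
    (hzτ : support F τ = ((τ : ℂ) * z).re)
    (hlast : ∀ w ∈ F, support F τ = ((τ : ℂ) * w).re →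
      s * ((τ : ℂ) * w).im ≤ s * ((τ : ℂ) * z).im)
    (hfreq : ∃ᶠ θ in 𝓝[>] (0 : ℝ), ∃ w ∈ F', support F (τ * Circle.exp (s * θ)) =
      (((τ * Circle.exp (s * θ) : Circle) : ℂ) * w).re) : z ∈ F' := by
  -- Choose turned directions tending to `τ` and minimizers in `F'`; a subsequential limit `w₀` of
  -- these will turn out to be `z`.
  have hpos : ∀ᶠ θ in 𝓝[>] (0 : ℝ), θ ∈ Ioo (0 : ℝ) 1 := Ioo_mem_nhdsGT one_pos
  obtain ⟨θ, hθ, hwin⟩ := exists_seq_forall_of_frequently (hfreq.and_eventually hpos)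
  choose w hwF hw using fun n => (hwin n).1
  obtain ⟨w₀, hw₀, φ, hφ, hlim⟩ := hF'.tendsto_subseq hwF
  have hcos : Tendsto (fun n => Real.cos (θ (φ n))) atTop (𝓝 1) := by
    have := (Real.continuous_cos.tendsto' 0 _ Real.cos_zero).comp
      ((hθ.mono_right nhdsWithin_le_nhds).comp hφ.tendsto_atTop)
    exact this
  have hsin : Tendsto (fun n => Real.sin (θ (φ n))) atTop (𝓝 0) := by
    have := (Real.continuous_sin.tendsto' 0 _ Real.sin_zero).comp
      ((hθ.mono_right nhdsWithin_le_nhds).comp hφ.tendsto_atTop)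
    exact this
  have hre : Tendsto (fun n => ((τ : ℂ) * w (φ n)).re) atTop (𝓝 ((τ : ℂ) * w₀).re) :=
    ((by fun_prop : Continuous fun u : ℂ => ((τ : ℂ) * u).re).tendsto w₀).comp hlim
  have him : Tendsto (fun n => ((τ : ℂ) * w (φ n)).im) atTop (𝓝 ((τ : ℂ) * w₀).im) :=
    ((by fun_prop : Continuous fun u : ℂ => ((τ : ℂ) * u).im).tendsto w₀).comp hlim
  have key : ∀ n, Real.cos (θ n) * ((τ : ℂ) * w n).re - Real.sin (θ n) * (s * ((τ : ℂ) * w n).im) ≤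
      Real.cos (θ n) * ((τ : ℂ) * z).re - Real.sin (θ n) * (s * ((τ : ℂ) * z).im) := by
    intro n
    have h := support_le hF (τ := τ * Circle.exp (s * θ n)) hz
    rw [hw n, re_mul_exp, re_mul_exp] at h
    rcases hs with rfl | rfl <;> simp only [one_mul, neg_mul, Real.cos_neg, Real.sin_neg] at h ⊢ <;>
      linarith
  have hle : ((τ : ℂ) * w₀).re ≤ ((τ : ℂ) * z).re := by
    have h1 := (hcos.mul hre).sub (hsin.mul (him.const_mul s))
    have h2 := (hcos.mul_const ((τ : ℂ) * z).re).sub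
      (hsin.mul_const (s * ((τ : ℂ) * z).im))
    simpa using le_of_tendsto_of_tendsto' h1 h2 fun n => key (φ n)
  have hmin : ∀ n, ((τ : ℂ) * z).re ≤ ((τ : ℂ) * w n).re := fun n =>
    hzτ ▸ support_le hF (hsub (hwF n))
  have hreq : ((τ : ℂ) * w₀).re = ((τ : ℂ) * z).re :=
    le_antisymm hle (hzτ ▸ support_le hF (hsub hw₀))
  -- The point `z` minimizes at `τ`, so the cosine terms of `key` may be dropped; dividing by the
  -- positive sine shows that `w₀` is at least as far along the face as `z`.
  have hge : s * ((τ : ℂ) * z).im ≤ s * ((τ : ℂ) * w₀).im := by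
    refine ge_of_tendsto' (him.const_mul s) fun n => ?_
    have h1 := key (φ n)
    obtain ⟨hp0, hp1⟩ := (hwin (φ n)).2
    have hsp : 0 < Real.sin (θ (φ n)) := Real.sin_pos_of_pos_of_lt_pi hp0
      (hp1.trans (by linarith [Real.pi_gt_three]))
    have hcp : 0 < Real.cos (θ (φ n)) := Real.cos_pos_of_mem_Ioo
      ⟨by linarith [Real.pi_gt_three], by linarith [Real.pi_gt_three]⟩
    have h2 := mul_le_mul_of_nonneg_left (hmin (φ n)) hcp.le
    exact le_of_mul_le_mul_left (by linarith) hsp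
  have himeq : ((τ : ℂ) * w₀).im = ((τ : ℂ) * z).im := by
    have h := le_antisymm (hlast w₀ (hsub hw₀) (hzτ.trans hreq.symm)) hge
    rcases hs with rfl | rfl <;> linarith
  have : (τ : ℂ) * w₀ = (τ : ℂ) * z := Complex.ext hreq himeq
  rwa [← mul_left_cancel₀ (Circle.coe_ne_zero τ) this]

/-! ### The label that wins on one side of a direction -/

/-- Replaces an equality of two minima by a minimizer of the whole fractal lying in the sub-fractal,
the form to which compactness and unique representation apply. -/
theorem wins_iff (hβ : 1 < ‖β‖) (hne : ∀ a, σ a ≠ []) {a : 𝒜} {b : Label σ} {τ : Circle} :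
    Wins σ β Γ a b τ ↔
      ∃ z ∈ subfractal σ β Γ a b, support (fractal σ β Γ a) τ = ((τ : ℂ) * z).re := by
  constructor
  · rintro ⟨hb, h⟩
    obtain ⟨z, hz, hz'⟩ := exists_support_eq (isCompact_subfractal (Γ := Γ) hβ a b)
      (subfractal_nonempty hne hb) τ
    exact ⟨z, hz, h.trans hz'⟩
  · rintro ⟨z, hz, h⟩
    have hb : b.IsLabelOf a := by
      obtain ⟨x, hx, -⟩ := hz
      exact hx.2 ▸ hx.1.1
    refine ⟨hb, le_antisymm ?_ (h ▸ support_le (isCompact_subfractal hβ a b) hz)⟩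
    obtain ⟨w, hw, hw'⟩ := exists_support_eq (isCompact_subfractal (Γ := Γ) hβ a b) ⟨z, hz⟩ τ
    rw [hw']
    exact support_le (isCompact_fractal hβ a) (subfractal_subset a b hw)

theorem exists_wins (hβ : 1 < ‖β‖) (hne : ∀ a, σ a ≠ []) (a : 𝒜) (τ : Circle) :
    ∃ b, Wins σ β Γ a b τ := by
  obtain ⟨b, hb⟩ := Label.exists_isLabelOf hne a
  obtain ⟨z, hz, h⟩ := exists_support_eq (isCompact_fractal (Γ := Γ) hβ a)
    ((subfractal_nonempty hne hb).mono (subfractal_subset a b)) τ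
  obtain ⟨c, -, hzc⟩ := exists_mem_subfractal hz
  exact ⟨c, (wins_iff hβ hne).2 ⟨z, hzc, h⟩⟩

/-- On each side of a direction there is a label which is the only one to win in the directions
close to the given one. -/
theorem exists_eventually_wins_iff (hβ : 1 < ‖β‖) (hne : ∀ a, σ a ≠ [])
    (hurp : UniqueRepresentation σ β Γ) (a : 𝒜) (τ : Circle) {s : ℝ} (hs : s = 1 ∨ s = -1) :
    ∃ b, Wins σ β Γ a b τ ∧
      ∀ᶠ θ in 𝓝[>] (0 : ℝ), ∀ c, Wins σ β Γ a c (τ * Circle.exp (s * θ)) ↔ c = b := by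
  have hF := isCompact_fractal (σ := σ) (Γ := Γ) hβ a
  obtain ⟨b₀, hb₀⟩ := Label.exists_isLabelOf hne a
  obtain ⟨z, hz, hzτ, hlast⟩ := exists_last_minimizer hF
    ((subfractal_nonempty (β := β) (Γ := Γ) hne hb₀).mono (subfractal_subset a b₀)) τ s
  have hmem : ∀ b, (∃ᶠ θ in 𝓝[>] (0 : ℝ), Wins σ β Γ a b (τ * Circle.exp (s * θ))) →
      z ∈ subfractal σ β Γ a b := fun b hb =>
    last_minimizer_mem hF (isCompact_subfractal hβ a b) (subfractal_subset a b) hs hz hzτ hlast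
      (hb.mono fun θ h => (wins_iff hβ hne).1 h)
  -- Some label wins in every direction and there are finitely many labels, so one of them wins
  -- frequently.
  obtain ⟨b, hb⟩ : ∃ b, ∃ᶠ θ in 𝓝[>] (0 : ℝ), Wins σ β Γ a b (τ * Circle.exp (s * θ)) :=
    frequently_exists.1 (Eventually.of_forall fun θ => exists_wins hβ hne a _).frequently
  refine ⟨b, (wins_iff hβ hne).2 ⟨z, hmem b hb, hzτ⟩, ?_⟩
  have hnot : ∀ᶠ θ in 𝓝[>] (0 : ℝ), ∀ c, Wins σ β Γ a c (τ * Circle.exp (s * θ)) → c = b := by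
    refine eventually_all.2 fun c => ?_
    by_cases hc : c = b
    · exact Eventually.of_forall fun _ _ => hc
    · have : ¬ ∃ᶠ θ in 𝓝[>] (0 : ℝ), Wins σ β Γ a c (τ * Circle.exp (s * θ)) := fun h =>
        hc (hurp.label_unique ⟨hz, τ, hzτ⟩ (hmem c h) (hmem b hb))
      exact (not_frequently.1 this).mono fun θ h h' => (h h').elim
  refine hnot.mono fun θ h c => ⟨h c, ?_⟩
  rintro rfl
  obtain ⟨d, hd⟩ := exists_wins (Γ := Γ) hβ hne a (τ * Circle.exp (s * θ))
  exact h d hd ▸ hd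

/-! ### Existence and uniqueness of the skew product -/

theorem existsUnique_isSkewProduct (hβ : 1 < ‖β‖) (hne : ∀ a, σ a ≠ [])
    (hurp : UniqueRepresentation σ β Γ) : ∃! H, IsSkewProduct σ β Γ H := by
  obtain ⟨ρ, hρ⟩ := exists_circle_eq hβ
  choose B hB hev using fun (a : 𝒜) (τ : Circle) =>
    exists_eventually_wins_iff hβ hne hurp a τ (Or.inl rfl)
  simp only [one_mul] at hev
  refine ⟨fun x => (ρ * x.1, B x.2.center x.1), (isSkewProduct_iff hρ _).2 fun τ b =>
    ⟨rfl, hB _ _, (hev b.center τ).mono fun θ h => (h _).1 (hB _ _)⟩, fun H hH => ?_⟩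
  replace hH := (isSkewProduct_iff hρ H).1 hH
  funext ⟨τ, b⟩
  obtain ⟨h1, h2, h3⟩ := hH τ b
  refine Prod.ext h1 ?_
  -- Right-continuity equates the label at `τ` with the label at a nearby direction to the right,
  -- where only one label wins.
  obtain ⟨θ, hθ, hθ'⟩ := (h3.and (hev b.center τ)).exists
  rw [← hθ]
  exact (hθ' _).1 (hH _ b).2.1

/-- The label of the image of the skew product is locally constant on the left, too. -/
theorem IsSkewProduct.eventually_left (hβ : 1 < ‖β‖) (hne : ∀ a, σ a ≠ [])
    (hurp : UniqueRepresentation σ β Γ) {H : Circle × Label σ → Circle × Label σ}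
    (hH : IsSkewProduct σ β Γ H) (τ : Circle) (b : Label σ) :
    ∃ c, ∀ᶠ θ in 𝓝[>] (0 : ℝ), (H (τ * Circle.exp (-θ), b)).2 = c := by
  obtain ⟨c, -, hc⟩ := exists_eventually_wins_iff hβ hne hurp b.center τ (Or.inr rfl)
  simp only [neg_mul, one_mul] at hc
  exact ⟨c, hc.mono fun θ h => (h _).1 ⟨hH.isLabelOf _ _, hH.attains _ _⟩⟩

end Fractals

/-! ### Forward orbits of irrational rotations -/

/-- Steps shorter than `b - a` cannot jump over `(a, b)`; the integer `m` places the start at or to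
the left of `a`. -/
theorem exists_add_int_add_nat_mul_mem_Ioo (y : ℝ) {a b x : ℝ} (hx : 0 < x) (hxb : x < b - a) :
    ∃ (j : ℕ) (m : ℤ), y + m + j * x ∈ Ioo a b := by
  refine ⟨⌊(a - (y + ⌊a - y⌋)) / x⌋₊ + 1, ⌊a - y⌋, ?_⟩
  have h0 : 0 ≤ (a - (y + ⌊a - y⌋)) / x := by
    have := Int.floor_le (a - y)
    exact div_nonneg (by linarith) hx.le
  have h1 := Nat.floor_le h0
  have h2 := Nat.lt_floor_add_one ((a - (y + ⌊a - y⌋)) / x)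
  rw [le_div_iff₀ hx] at h1
  rw [div_lt_iff₀ hx] at h2
  push_cast
  constructor <;> nlinarith

/-- Dirichlet approximation gives a multiple of `φ` close to an integer, and irrationality makes the
error nonzero, so it serves as a short step; a negative step is handled by reflection. The
multiplier is a natural number because only forward iterates of `f` are available. -/
theorem exists_nat_mul_add_int_mem_Ioo {φ : ℝ} (hφ : Irrational φ) (θ : ℝ) {a b : ℝ}
    (hab : a < b) : ∃ (k : ℕ) (n : ℤ), θ + k * φ + n ∈ Ioo a b := by
  obtain ⟨q, hq⟩ := exists_nat_one_div_lt (sub_pos.2 hab)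
  obtain ⟨k, hk0, -, hk⟩ := Real.exists_nat_abs_mul_sub_round_le φ (Nat.succ_pos q)
  have hlt : |k * φ - round (k * φ)| < b - a := by
    refine lt_of_le_of_lt (hk.trans ?_) hq
    push_cast
    exact one_div_le_one_div_of_le (by positivity) (by linarith)
  have hne : (k : ℝ) * φ - round (k * φ) ≠ 0 :=
    ((hφ.natCast_mul hk0.ne').sub_intCast _).ne_zero
  rcases hne.lt_or_gt with h | h
  · rw [abs_of_neg h] at hlt
    obtain ⟨j, m, h1, h2⟩ := exists_add_int_add_nat_mul_mem_Ioo (-θ) (a := -b) (b := -a)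
      (neg_pos.2 h) (by linarith)
    refine ⟨j * k, -m - j * round (k * φ), ?_⟩
    push_cast
    constructor <;> nlinarith
  · rw [abs_of_pos h] at hlt
    obtain ⟨j, m, h1, h2⟩ := exists_add_int_add_nat_mul_mem_Ioo θ (a := a) (b := b) h hlt
    refine ⟨j * k, m - j * round (k * φ), ?_⟩
    push_cast
    constructor <;> nlinarith

theorem tendsto_div_nhdsGT_zero {c : ℝ} (hc : 0 < c) :
    Tendsto (fun x : ℝ => x / c) (𝓝[>] 0) (𝓝[>] 0) := by
  refine tendsto_nhdsWithin_iff.2 ⟨?_, eventually_mem_nhdsWithin.mono fun x hx => div_pos hx hc⟩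
  exact ((continuous_id.div_const c).tendsto' 0 0 (by simp)).mono_left nhdsWithin_le_nhds

theorem tendsto_mul_nhdsGT_zero {c : ℝ} (hc : 0 < c) :
    Tendsto (fun x : ℝ => c * x) (𝓝[>] 0) (𝓝[>] 0) := by
  refine tendsto_nhdsWithin_iff.2 ⟨?_, eventually_mem_nhdsWithin.mono fun x hx => mul_pos hc hx⟩
  exact ((continuous_const.mul continuous_id).tendsto' 0 0 (by simp)).mono_left nhdsWithin_le_nhds

theorem eventually_nhdsGT_zero_iff {p : ℝ → Prop} :
    (∀ᶠ x in 𝓝[>] (0 : ℝ), p x) ↔ ∃ ε > 0, ∀ x, 0 < x → x < ε → p x := by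
  rw [(nhdsGT_basis (0 : ℝ)).eventually_iff]
  exact ⟨fun ⟨ε, h, h'⟩ => ⟨ε, h, fun x h1 h2 => h' ⟨h1, h2⟩⟩,
    fun ⟨ε, h, h'⟩ => ⟨ε, h, fun x hx => h' x hx.1 hx.2⟩⟩

/-! ### Piecewise translations of `[0, 1)` that extend an irrational rotation -/

/-- The map `f` is a right-continuous piecewise translation of `[0, 1)` into itself, which is
semiconjugate to the irrational rotation by `φ` via `t ↦ N t` modulo `1`. -/
structure IsRotationExtension (f : ℝ → ℝ) (N : ℕ) (φ : ℝ) : Prop where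
  pos : 0 < N
  irrational : Irrational φ
  mapsTo : ∀ t ∈ Ico (0 : ℝ) 1, f t ∈ Ico (0 : ℝ) 1
  right : ∀ t ∈ Ico (0 : ℝ) 1, ∀ᶠ x in 𝓝[>] (0 : ℝ), f (t + x) = f t + x
  left : ∀ t ∈ Ioc (0 : ℝ) 1, ∃ y, ∀ᶠ x in 𝓝[>] (0 : ℝ), f (t - x) = y - x
  semiconj : ∀ t ∈ Ico (0 : ℝ) 1, ∃ n : ℤ, N * f t = N * t + φ + n

theorem eventually_sub_mem_Ico {t : ℝ} (ht : t ∈ Ioc (0 : ℝ) 1) :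
    ∀ᶠ x in 𝓝[>] (0 : ℝ), t - x ∈ Ico (0 : ℝ) 1 :=
  eventually_nhdsGT_zero_iff.2 ⟨t, ht.1, fun x h1 h2 => ⟨by linarith, by linarith [ht.2]⟩⟩

theorem eventually_add_mem_Ico {t : ℝ} (ht : t ∈ Ico (0 : ℝ) 1) :
    ∀ᶠ x in 𝓝[>] (0 : ℝ), t + x ∈ Ico (0 : ℝ) 1 :=
  eventually_nhdsGT_zero_iff.2 ⟨1 - t, by linarith [ht.2], fun x h1 h2 =>
    ⟨by linarith [ht.1], by linarith⟩⟩

theorem mem_Ioc_of_eventually_sub_mem_Ico {y : ℝ}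
    (h : ∀ᶠ x in 𝓝[>] (0 : ℝ), y - x ∈ Ico (0 : ℝ) 1) : y ∈ Ioc (0 : ℝ) 1 := by
  obtain ⟨ε, hε, h⟩ := eventually_nhdsGT_zero_iff.1 h
  refine ⟨by linarith [(h (ε / 2) (by linarith) (by linarith)).1], le_of_not_gt fun hy => ?_⟩
  have h1 : 0 < min (ε / 2) (y - 1) := lt_min (by linarith) (by linarith)
  have h2 := (h _ h1 (by linarith [min_le_left (ε / 2) (y - 1)])).2
  linarith [min_le_right (ε / 2) (y - 1)]

/-- `J` is a nonempty subset of `[0, 1)` which is mapped onto itself by `f` and which is closed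
from the right. -/
structure IsRightClosedInvariant (f : ℝ → ℝ) (J : Set ℝ) : Prop where
  subset : J ⊆ Ico 0 1
  nonempty : J.Nonempty
  image_eq : f '' J = J
  right : ∀ t ∈ Ico (0 : ℝ) 1, t ∉ J → ∀ᶠ x in 𝓝[>] (0 : ℝ), t + x ∉ J

/-- The points of `J` over the point `θ` of the circle `ℝ / ℤ`. -/
def fibre (N : ℕ) (J : Set ℝ) (θ : ℝ) : Set ℝ := {t | t ∈ J ∧ ∃ n : ℤ, N * t = θ + n}

theorem fibre_add_int (N : ℕ) (J : Set ℝ) (θ : ℝ) (n : ℤ) : fibre N J (θ + n) = fibre N J θ := by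
  ext t
  refine and_congr_right fun _ => ⟨fun ⟨m, hm⟩ => ⟨n + m, by push_cast; linarith⟩,
    fun ⟨m, hm⟩ => ⟨m - n, by push_cast; linarith⟩⟩

theorem mem_fibre_self {N : ℕ} {J : Set ℝ} {t : ℝ} (ht : t ∈ J) : t ∈ fibre N J (N * t) :=
  ⟨ht, 0, by simp⟩

theorem fibre_finite {N : ℕ} (hN : 0 < N) {J : Set ℝ} (hJ : J ⊆ Ico 0 1) (θ : ℝ) :
    (fibre N J θ).Finite := by
  have hN' : (0 : ℝ) < N := Nat.cast_pos.2 hN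
  refine ((Set.finite_Icc ⌊-θ⌋ ⌈N - θ⌉).image fun n : ℤ => (θ + n) / N).subset ?_
  rintro t ⟨ht, n, hn⟩
  obtain ⟨h0, h1⟩ := hJ ht
  refine ⟨n, ⟨?_, ?_⟩, ?_⟩
  · refine Int.cast_le (R := ℝ).1 ((Int.floor_le _).trans ?_)
    nlinarith
  · refine Int.cast_le (R := ℝ).1 (le_trans ?_ (Int.le_ceil _))
    nlinarith
  · simp only
    rw [← hn]
    field_simp

/-! ### Fibres of right-closed invariant sets -/

namespace IsRightClosedInvariant

variable {f : ℝ → ℝ} {N : ℕ} {φ : ℝ} {J : Set ℝ}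

theorem image_fibre (hJ : IsRightClosedInvariant f J) (hf : IsRotationExtension f N φ) (θ : ℝ) :
    f '' fibre N J θ = fibre N J (θ + φ) := by
  ext y
  constructor
  · rintro ⟨t, ⟨ht, n, hn⟩, rfl⟩
    obtain ⟨m, hm⟩ := hf.semiconj t (hJ.subset ht)
    exact ⟨hJ.image_eq ▸ mem_image_of_mem f ht, n + m, by push_cast; linarith⟩
  · rintro ⟨hy, n, hn⟩
    obtain ⟨t, ht, rfl⟩ := hJ.image_eq.symm ▸ hy
    obtain ⟨m, hm⟩ := hf.semiconj t (hJ.subset ht)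
    exact ⟨t, ⟨ht, n - m, by push_cast; linarith⟩, rfl⟩

theorem image_iterate_fibre (hJ : IsRightClosedInvariant f J) (hf : IsRotationExtension f N φ)
    (k : ℕ) (θ : ℝ) : f^[k] '' fibre N J θ = fibre N J (θ + k * φ) := by
  induction k with
  | zero => simp
  | succ k ih =>
    rw [Function.iterate_succ', image_comp, ih, hJ.image_fibre hf]
    congr 1
    push_cast
    ring

/-- Only finitely many points of `[0, 1)` lie over `θ`, and each one missing from `J` has a gap of
`J` to its right. A common gap length therefore works for all of them. -/
theorem eventually_sub_mem_fibre (hJ : IsRightClosedInvariant f J)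
    (hf : IsRotationExtension f N φ) (θ : ℝ) :
    ∀ᶠ x in 𝓝[>] (0 : ℝ), ∀ t ∈ fibre N J (θ + x), t - x / N ∈ fibre N J θ := by
  have hN : (0 : ℝ) < N := Nat.cast_pos.2 hf.pos
  have hfin : (fun n : ℤ => (θ + n) / N) ⁻¹' fibre N (Ico 0 1) θ |>.Finite := by
    refine (fibre_finite hf.pos subset_rfl θ).preimage fun a _ b _ h => ?_
    simpa [div_left_inj' hN.ne'] using h
  have h1 : ∀ᶠ x in 𝓝[>] (0 : ℝ), ∀ n ∈ (fun n : ℤ => (θ + n) / N) ⁻¹' fibre N (Ico 0 1) θ,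
      (θ + n) / N ∉ J → (θ + n) / N + x / N ∉ J := by
    rw [eventually_all_finite hfin]
    intro n hn
    by_cases h : (θ + n) / N ∈ J
    · exact Eventually.of_forall fun x h' => (h' h).elim
    · exact ((tendsto_div_nhdsGT_zero hN).eventually (hJ.right _ hn.1 h)).mono fun x hx _ => hx
  -- Keeps `θ + x` below the next integer, so that moving back by `x / N` does not leave `[0, 1)` at
  -- `0`.
  have h2 : ∀ᶠ x in 𝓝[>] (0 : ℝ), x ∈ Ioo 0 (1 - Int.fract θ) :=
    Ioo_mem_nhdsGT (sub_pos.2 (Int.fract_lt_one θ))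
  filter_upwards [h1, h2] with x hx hx' t ht
  obtain ⟨htJ, n, hn⟩ := ht
  obtain ⟨ht0, ht1⟩ := hJ.subset htJ
  have e : t - x / N = (θ + n) / N := by
    field_simp
    linarith
  have hnn : 0 ≤ θ + n := by
    have h3 : (-1 : ℝ) < ⌊θ⌋ + n := by
      have := Int.floor_add_fract θ
      have : 0 ≤ (N : ℝ) * t := by positivity
      linarith [hx'.2]
    have h4 : 0 ≤ ⌊θ⌋ + n := by
      have : (-1 : ℤ) < ⌊θ⌋ + n := by exact_mod_cast h3
      omega
    have h5 : (0 : ℝ) ≤ ⌊θ⌋ + n := by exact_mod_cast h4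
    linarith [Int.floor_le θ]
  have hmem : (θ + n) / N ∈ fibre N (Ico 0 1) θ := by
    refine ⟨⟨by positivity, ?_⟩, n, by field_simp⟩
    rw [← e]
    linarith [div_pos hx'.1 hN]
  rw [e]
  refine ⟨by_contra fun h => hx n hmem h ?_, n, by field_simp⟩
  rw [← e]
  simpa using htJ

theorem ncard_fibre_le_of_eventually (hJ : IsRightClosedInvariant f J)
    (hf : IsRotationExtension f N φ) {θ x : ℝ}
    (h : ∀ t ∈ fibre N J (θ + x), t - x / N ∈ fibre N J θ) :
    (fibre N J (θ + x)).ncard ≤ (fibre N J θ).ncard :=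
  ncard_le_ncard_of_injOn _ h (fun _ _ _ _ h => by simpa using h) (fibre_finite hf.pos hJ.subset θ)

/-- All fibres have the same number of points. -/
theorem ncard_fibre_eq (hJ : IsRightClosedInvariant f J) (hf : IsRotationExtension f N φ)
    (θ θ' : ℝ) : (fibre N J θ).ncard = (fibre N J θ').ncard := by
  obtain ⟨θ₀, h₀⟩ : ∃ θ₀, ∀ θ, (fibre N J θ₀).ncard ≤ (fibre N J θ).ncard := by
    obtain ⟨θ₀, h⟩ := Nat.sInf_mem (range_nonempty fun θ => (fibre N J θ).ncard)
    exact ⟨θ₀, fun θ => h.trans_le (Nat.sInf_le ⟨θ, rfl⟩)⟩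
  suffices ∀ θ, (fibre N J θ).ncard = (fibre N J θ₀).ncard from (this θ).trans (this θ').symm
  refine fun θ => le_antisymm ?_ (h₀ θ)
  obtain ⟨ε, hε, h⟩ := eventually_nhdsGT_zero_iff.1 (hJ.eventually_sub_mem_fibre hf θ₀)
  -- Rotate `θ` backwards into the interval just right of `θ₀`. The fibre over `θ` is then the image
  -- under `f^[k]` of a fibre with at most the minimal number of points.
  obtain ⟨k, n, hk⟩ :=
    exists_nat_mul_add_int_mem_Ioo hf.irrational.neg θ (by linarith : θ₀ < θ₀ + ε)
  have e : θ = θ₀ + (θ + k * -φ + n - θ₀) + k * φ + (-n : ℤ) := by push_cast; ring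
  rw [e, fibre_add_int, ← hJ.image_iterate_fibre hf]
  refine (ncard_image_le (fibre_finite hf.pos hJ.subset _)).trans ?_
  exact hJ.ncard_fibre_le_of_eventually hf
    (h _ (by linarith [hk.1]) (by linarith [hk.2]))

theorem fibre_nonempty (hJ : IsRightClosedInvariant f J) (hf : IsRotationExtension f N φ) (θ : ℝ) :
    (fibre N J θ).Nonempty := by
  obtain ⟨t, ht⟩ := hJ.nonempty
  have hfin := fibre_finite hf.pos hJ.subset
  rw [← ncard_pos (hfin θ), hJ.ncard_fibre_eq hf θ (N * t), ncard_pos (hfin _)]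
  exact ⟨t, mem_fibre_self ht⟩

/-- Points with equal images lie in the same fibre, and a surjection between finite fibres of equal
cardinality is injective. -/
theorem injOn (hJ : IsRightClosedInvariant f J) (hf : IsRotationExtension f N φ) :
    InjOn f J := by
  intro t ht s hs hts
  obtain ⟨n, hn⟩ := hf.semiconj t (hJ.subset ht)
  obtain ⟨m, hm⟩ := hf.semiconj s (hJ.subset hs)
  have hinj : InjOn f (fibre N J (N * t)) := by
    refine injOn_of_ncard_image_eq ?_ (fibre_finite hf.pos hJ.subset _)
    rw [hJ.image_fibre hf]
    exact hJ.ncard_fibre_eq hf _ _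
  exact hinj (mem_fibre_self ht) ⟨hs, n - m, by push_cast; rw [hts] at hn; linarith⟩ hts

/-- The backward translation embeds the nearby fibre into the fibre over `θ`; equal cardinality
makes it onto. -/
theorem eventually_fibre_add (hJ : IsRightClosedInvariant f J) (hf : IsRotationExtension f N φ)
    (θ : ℝ) : ∀ᶠ x in 𝓝[>] (0 : ℝ), fibre N J (θ + x) = (fun t => t + x / N) '' fibre N J θ := by
  refine (hJ.eventually_sub_mem_fibre hf θ).mono fun x hx => ?_
  have h : (fun t => t - x / N) '' fibre N J (θ + x) = fibre N J θ := by
    refine eq_of_subset_of_ncard_le (image_subset_iff.2 hx) ?_ (fibre_finite hf.pos hJ.subset θ)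
    rw [ncard_image_of_injective _ fun a b h => by simpa using h]
    exact (hJ.ncard_fibre_eq hf _ _).le
  rw [← h, image_image]
  simp

theorem eventually_add_mem (hJ : IsRightClosedInvariant f J) (hf : IsRotationExtension f N φ)
    {t : ℝ} (ht : t ∈ J) : ∀ᶠ x in 𝓝[>] (0 : ℝ), t + x ∈ J := by
  have hN : (0 : ℝ) < N := Nat.cast_pos.2 hf.pos
  filter_upwards [(tendsto_mul_nhdsGT_zero hN).eventually (hJ.eventually_fibre_add hf (N * t))]
    with x hx
  have h : t + N * x / N ∈ fibre N J (N * t + N * x) := hx ▸ ⟨t, mem_fibre_self ht, rfl⟩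
  rw [mul_div_cancel_left₀ _ hN.ne'] at h
  exact h.1

end IsRightClosedInvariant

theorem IsRotationExtension.left_iterate {f : ℝ → ℝ} {N : ℕ} {φ : ℝ}
    (hf : IsRotationExtension f N φ) (k : ℕ) : ∀ t ∈ Ioc (0 : ℝ) 1,
    ∃ y, ∀ᶠ x in 𝓝[>] (0 : ℝ), f^[k] (t - x) = y - x := by
  induction k with
  | zero => exact fun t _ => ⟨t, by simp⟩
  | succ k ih =>
    intro t ht
    obtain ⟨y, hy⟩ := hf.left t ht
    have hy' : y ∈ Ioc (0 : ℝ) 1 := mem_Ioc_of_eventually_sub_mem_Ico <| by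
      filter_upwards [hy, eventually_sub_mem_Ico ht] with x hx hx'
      exact hx ▸ hf.mapsTo _ hx'
    obtain ⟨z, hz⟩ := ih y hy'
    refine ⟨z, ?_⟩
    filter_upwards [hy, hz] with x hx hx'
    rw [Function.iterate_succ_apply, hx, hx']

/-- Nothing is assumed about `J` on the left of a point. However, the fibres over a short interval
`(0, ε)` are translates of the one over `0`, and `f^[k]` carries those just below some `y` in it to
those just below `N t`. -/
theorem IsRightClosedInvariant.eventually_sub_mem_iff {f : ℝ → ℝ} {N : ℕ} {φ : ℝ} {J : Set ℝ}
    (hJ : IsRightClosedInvariant f J) (hf : IsRotationExtension f N φ) (t : ℝ) :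
    ∃ p : Prop, ∀ᶠ x in 𝓝[>] (0 : ℝ), (t - x ∈ J ↔ p) := by
  have hN : (0 : ℝ) < N := Nat.cast_pos.2 hf.pos
  obtain ⟨ε, hε, h⟩ := eventually_nhdsGT_zero_iff.1 (hJ.eventually_fibre_add hf 0)
  obtain ⟨k, n, hy0, hyε⟩ := exists_nat_mul_add_int_mem_Ioo hf.irrational.neg (N * t) hε
  set y := N * t + k * -φ + n with hy
  have hmem : ∀ u ∈ fibre N J 0, u + y / N ∈ Ioc (0 : ℝ) 1 := fun u hu => by
    have h1 : u + y / N ∈ fibre N J (0 + y) := h y hy0 hyε ▸ ⟨u, hu, rfl⟩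
    exact ⟨by linarith [(hJ.subset hu.1).1, div_pos hy0 hN], (hJ.subset h1.1).2.le⟩
  choose! g hg using fun u hu => hf.left_iterate k _ (hmem u hu)
  -- Here `g u` is the left limit of `f^[k]` at `u + y / N`: the left germ at `t` is in `J` exactly
  -- when it is the image of one of these left germs.
  refine ⟨∃ u ∈ fibre N J 0, g u = t, ?_⟩
  have h2 : ∀ᶠ x in 𝓝[>] (0 : ℝ), ∀ u ∈ fibre N J 0, f^[k] (u + y / N - x) = g u - x :=
    (eventually_all_finite (fibre_finite hf.pos hJ.subset 0)).2 hg
  filter_upwards [h2, (Ioo_mem_nhdsGT (div_pos hy0 hN) : Ioo 0 (y / N) ∈ 𝓝[>] (0 : ℝ))]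
    with x hx hx'
  have hx'' : x * N < y := (lt_div_iff₀ hN).1 hx'.2
  have hx0 : 0 < x * N := mul_pos hx'.1 hN
  have e : N * (t - x) = 0 + (y - x * N) + k * φ + (-n : ℤ) := by
    rw [hy]; push_cast; ring
  have hfib : fibre N J (N * (t - x)) = (fun u => g u - x) '' fibre N J 0 := by
    rw [e, fibre_add_int, ← hJ.image_iterate_fibre hf, h _ (by linarith) (by linarith), image_image]
    refine image_congr fun u hu => ?_
    rw [← hx u hu]
    congr 1
    field_simp
    ring
  constructor
  · intro hmem
    obtain ⟨u, hu, hu'⟩ := hfib ▸ mem_fibre_self (N := N) hmem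
    exact ⟨u, hu, by simpa using hu'⟩
  · rintro ⟨u, hu, hu'⟩
    have : t - x ∈ fibre N J (N * (t - x)) := by
      rw [hfib]
      exact ⟨u, hu, by simp [hu']⟩
    exact this.1

/-! ### Partition into intervals -/

/-- If all short intervals to the right of a point and all short intervals to the left of a point
satisfy `R`, then `[a, b)` can be cut into finitely many intervals that satisfy `R`. -/
theorem reflTransGen_of_eventually {R : ℝ → ℝ → Prop} {a b : ℝ} (hab : a ≤ b)
    (hright : ∀ t ∈ Ico a b, ∀ᶠ x in 𝓝[>] (0 : ℝ), R t (t + x))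
    (hleft : ∀ t ∈ Ioc a b, ∀ᶠ x in 𝓝[>] (0 : ℝ), R (t - x) t) :
    Relation.ReflTransGen R a b := by
  set S := {x | x ∈ Icc a b ∧ Relation.ReflTransGen R a x} with hS
  have haS : a ∈ S := ⟨left_mem_Icc.2 hab, .refl⟩
  have hbdd : BddAbove S := ⟨b, fun x hx => hx.1.2⟩
  have hsab : sSup S ∈ Icc a b := ⟨le_csSup hbdd haS, csSup_le ⟨a, haS⟩ fun x hx => hx.1.2⟩
  have hs : Relation.ReflTransGen R a (sSup S) := by
    rcases hsab.1.eq_or_lt with h | h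
    · rw [← h]
    · obtain ⟨ε, hε, h'⟩ := eventually_nhdsGT_zero_iff.1 (hleft _ ⟨h, hsab.2⟩)
      obtain ⟨x, hxS, hx⟩ := exists_lt_of_lt_csSup ⟨a, haS⟩ (by linarith : sSup S - ε < sSup S)
      rcases (le_csSup hbdd hxS).eq_or_lt with h1 | h1
      · exact h1 ▸ hxS.2
      · have := h' (sSup S - x) (by linarith) (by linarith)
        rw [sub_sub_cancel] at this
        exact hxS.2.tail this
  rcases hsab.2.eq_or_lt with h | h
  · exact h ▸ hs
  -- If the supremum were less than `b`, one more step to the right would exceed it.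
  · have h1 : ∀ᶠ x in 𝓝[>] (0 : ℝ), x ∈ Ioo 0 (b - sSup S) := Ioo_mem_nhdsGT (sub_pos.2 h)
    obtain ⟨x, hx, hx0, hx1⟩ := ((hright _ ⟨hsab.1, h⟩).and h1).exists
    have : sSup S + x ∈ S := ⟨⟨by linarith [hsab.1], by linarith⟩, hs.tail hx⟩
    linarith [le_csSup hbdd this]

/-- The interval `[u, v)` is contained in `J` or disjoint from `J`, and `f` is a translation
on it. -/
def IsPiece (f : ℝ → ℝ) (J : Set ℝ) (u v : ℝ) : Prop :=
  u < v ∧ (Ico u v ⊆ J ∨ Disjoint (Ico u v) J) ∧ ∃ d, ∀ t ∈ Ico u v, f t = t + d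

theorem exists_intervals_of_reflTransGen {f : ℝ → ℝ} {J : Set ℝ} {a b : ℝ}
    (h : Relation.ReflTransGen (IsPiece f J) a b) :
    a ≤ b ∧ ∃ (k : ℕ) (u v d : Fin k → ℝ), (∀ i, u i < v i) ∧
      (Pairwise fun i j => Disjoint (Ico (u i) (v i)) (Ico (u j) (v j))) ∧
      (⋃ i, Ico (u i) (v i)) = J ∩ Ico a b ∧ ∀ i, ∀ t ∈ Ico (u i) (v i), f t = t + d i := by
  induction h with
  | refl => exact ⟨le_rfl, 0, Fin.elim0, Fin.elim0, Fin.elim0, by simp [Pairwise]⟩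
  | @tail b c _ hbc ih =>
    obtain ⟨hab, k, u, v, d, h1, h2, h3, h4⟩ := ih
    obtain ⟨hlt, hJ, e, he⟩ := hbc
    refine ⟨hab.trans hlt.le, ?_⟩
    have hsplit : J ∩ Ico a c = J ∩ Ico b c ∪ J ∩ Ico a b := by
      rw [← Ico_union_Ico_eq_Ico hab hlt.le, inter_union_distrib_left, union_comm]
    rcases hJ with hJ | hJ
    · have hdisj : ∀ i, Disjoint (Ico b c) (Ico (u i) (v i)) := fun i => by
        refine Disjoint.mono_right ((subset_iUnion _ i).trans (h3.le.trans inter_subset_right)) ?_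
        exact (Ico_disjoint_Ico_same (a := a)).symm
      refine ⟨k + 1, Fin.cons b u, Fin.cons c v, Fin.cons e d, ?_, ?_, ?_, ?_⟩
      · exact Fin.cases hlt h1
      · intro i j
        refine Fin.cases ?_ (fun i => ?_) i <;> refine Fin.cases ?_ (fun j => ?_) j
        · exact fun h => (h rfl).elim
        · exact fun _ => hdisj j
        · exact fun _ => (hdisj i).symm
        · exact fun h => h2 fun hij => h (congrArg Fin.succ hij)
      · rw [hsplit, ← h3, inter_eq_right.2 hJ]
        ext t
        simp [Fin.exists_fin_succ]
      · exact Fin.cases he h4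
    · refine ⟨k, u, v, d, h1, h2, ?_, h4⟩
      rw [h3, hsplit, inter_comm J (Ico b c), disjoint_iff_inter_eq_empty.1 hJ, empty_union]

theorem IsRightClosedInvariant.exists_isIEM {f : ℝ → ℝ} {N : ℕ} {φ : ℝ} {J : Set ℝ}
    (hJ : IsRightClosedInvariant f J) (hf : IsRotationExtension f N φ) :
    ∃ (k : ℕ) (u v d : Fin k → ℝ), IsIEM f J u v d := by
  have h : Relation.ReflTransGen (IsPiece f J) 0 1 := by
    refine reflTransGen_of_eventually zero_le_one (fun t ht => ?_) fun t ht => ?_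
    · have h1 : ∀ᶠ x in 𝓝[>] (0 : ℝ), (t + x ∈ J ↔ t ∈ J) := by
        by_cases h : t ∈ J
        · exact (hJ.eventually_add_mem hf h).mono fun x hx => iff_of_true hx h
        · exact (hJ.right t ht h).mono fun x hx => iff_of_false hx h
      obtain ⟨ε, hε, h2⟩ := eventually_nhdsGT_zero_iff.1 (h1.and (hf.right t ht))
      refine eventually_nhdsGT_zero_iff.2 ⟨ε, hε, fun x hx0 hxε => ?_⟩
      have h3 : ∀ s ∈ Ico t (t + x), (s ∈ J ↔ t ∈ J) ∧ f s = s + (f t - t) := fun s hs => by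
        rcases hs.1.eq_or_lt with rfl | hlt
        · exact ⟨Iff.rfl, by ring⟩
        · have := h2 (s - t) (by linarith) (by linarith [hs.2])
          rw [add_sub_cancel] at this
          exact ⟨this.1, by linarith [this.2]⟩
      refine ⟨by linarith, ?_, f t - t, fun s hs => (h3 s hs).2⟩
      by_cases h : t ∈ J
      · exact Or.inl fun s hs => (h3 s hs).1.2 h
      · exact Or.inr (disjoint_left.2 fun s hs hsJ => h ((h3 s hs).1.1 hsJ))
    · obtain ⟨p, hp⟩ := hJ.eventually_sub_mem_iff hf t
      obtain ⟨y, hy⟩ := hf.left t ht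
      obtain ⟨ε, hε, h2⟩ := eventually_nhdsGT_zero_iff.1 (hp.and hy)
      refine eventually_nhdsGT_zero_iff.2 ⟨ε, hε, fun x hx0 hxε => ?_⟩
      have h3 : ∀ s ∈ Ico (t - x) t, (s ∈ J ↔ p) ∧ f s = s + (y - t) := fun s hs => by
        have := h2 (t - s) (by linarith [hs.2]) (by linarith [hs.1])
        rw [sub_sub_cancel] at this
        exact ⟨this.1, by linarith [this.2]⟩
      refine ⟨by linarith, ?_, y - t, fun s hs => (h3 s hs).2⟩
      by_cases h : p
      · exact Or.inl fun s hs => (h3 s hs).1.2 h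
      · exact Or.inr (disjoint_left.2 fun s hs hsJ => h ((h3 s hs).1.1 hsJ))
  obtain ⟨-, k, u, v, d, h1, h2, h3, h4⟩ := exists_intervals_of_reflTransGen h
  refine ⟨k, u, v, d, h1, h2, h3.trans (inter_eq_left.2 hJ.subset), h4, ?_⟩
  exact ⟨fun t ht => hJ.image_eq ▸ mem_image_of_mem f ht, hJ.injOn hf, hJ.image_eq.ge⟩

/-! ### Minimal sets of continuous maps -/

/-- Zorn's lemma gives a minimal nonempty closed forward-invariant set `K`. Both `F '' K` and the
orbit closure of any point of `K` are sets of the same kind inside `K`, hence equal to it. -/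
theorem exists_minimal_set {X : Type*} [TopologicalSpace X] [CompactSpace X] [T2Space X]
    [Nonempty X] {F : X → X} (hF : Continuous F) :
    ∃ K : Set X, K.Nonempty ∧ IsClosed K ∧ F '' K = K ∧
      ∀ x ∈ K, K ⊆ closure (range fun n : ℕ => F^[n] x) := by
  obtain ⟨K, hK⟩ := zorn_superset {K : Set X | K.Nonempty ∧ IsClosed K ∧ MapsTo F K K} <| by
    intro c hc hchain
    rcases c.eq_empty_or_nonempty with rfl | hne
    · exact ⟨univ, ⟨univ_nonempty, isClosed_univ, mapsTo_univ _ _⟩, by simp⟩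
    · refine ⟨⋂₀ c, ⟨?_, isClosed_sInter fun s hs => (hc hs).2.1, fun x hx s hs =>
        (hc hs).2.2 (hx s hs)⟩, fun s hs => sInter_subset_of_mem hs⟩
      have := hne.to_subtype
      refine IsCompact.nonempty_sInter_of_directed_nonempty_isCompact_isClosed
        (fun a ha b hb => ?_) (fun s hs => (hc hs).1) (fun s hs => (hc hs).2.1.isCompact)
        fun s hs => (hc hs).2.1
      exact (hchain.total ha hb).elim (fun h => ⟨a, ha, subset_rfl, h⟩) fun h =>
        ⟨b, hb, h, subset_rfl⟩
  obtain ⟨hne, hcl, hmaps⟩ := hK.prop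
  refine ⟨K, hne, hcl, ?_, fun x hx => ?_⟩
  · exact hK.eq_of_subset ⟨hne.image F, (hcl.isCompact.image hF).isClosed, fun y hy =>
      mem_image_of_mem F (hmaps.image_subset hy)⟩ hmaps.image_subset
  · have hmem : ∀ n : ℕ, F^[n] x ∈ K := fun n => hmaps.iterate n hx
    refine (hK.eq_of_subset ⟨⟨x, subset_closure (mem_range_self 0)⟩, isClosed_closure, ?_⟩ ?_).ge
    · refine MapsTo.closure ?_ hF
      rintro _ ⟨n, rfl⟩
      exact ⟨n + 1, Function.iterate_succ_apply' F n x⟩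
    · exact closure_minimal (range_subset_iff.2 hmem) hcl

/-! ### The left-continuous version of a piecewise translation -/

theorem leftLim_eq_of_eventually {f : ℝ → ℝ} {t y : ℝ}
    (h : ∀ᶠ x in 𝓝[>] (0 : ℝ), f (t - x) = y - x) : Function.leftLim f t = y := by
  have h1 : Tendsto (fun s => t - s) (𝓝[<] t) (𝓝[>] 0) := by
    refine tendsto_nhdsWithin_iff.2 ⟨?_, eventually_mem_nhdsWithin.mono fun x hx =>
      sub_pos.2 (mem_Iio.1 hx)⟩
    exact ((continuous_const.sub continuous_id).tendsto' t 0 (by simp)).mono_left nhdsWithin_le_nhds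
  refine leftLim_eq_of_tendsto ?_
  have h2 : Tendsto (fun s => y - (t - s)) (𝓝[<] t) (𝓝 y) :=
    (Continuous.tendsto' (by fun_prop) t y (by simp)).mono_left nhdsWithin_le_nhds
  refine h2.congr' ((h1.eventually h).mono fun s hs => ?_)
  rw [← hs, sub_sub_cancel]

namespace IsRotationExtension

variable {f : ℝ → ℝ} {N : ℕ} {φ : ℝ}

theorem eventually_leftLim (hf : IsRotationExtension f N φ) {t : ℝ} (ht : t ∈ Ioc (0 : ℝ) 1) :
    ∀ᶠ x in 𝓝[>] (0 : ℝ), f (t - x) = Function.leftLim f t - x := by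
  obtain ⟨y, hy⟩ := hf.left t ht
  rwa [leftLim_eq_of_eventually hy]

theorem leftLim_mem (hf : IsRotationExtension f N φ) {t : ℝ} (ht : t ∈ Ioc (0 : ℝ) 1) :
    Function.leftLim f t ∈ Ioc (0 : ℝ) 1 := by
  refine mem_Ioc_of_eventually_sub_mem_Ico ?_
  filter_upwards [hf.eventually_leftLim ht, eventually_sub_mem_Ico ht] with x hx hx'
  exact hx ▸ hf.mapsTo _ hx'

theorem leftLim_iterate_mem (hf : IsRotationExtension f N φ) {t : ℝ} (ht : t ∈ Ioc (0 : ℝ) 1)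
    (n : ℕ) : (Function.leftLim f)^[n] t ∈ Ioc (0 : ℝ) 1 :=
  MapsTo.iterate (fun _ h => hf.leftLim_mem h) n ht

theorem leftLim_semiconj (hf : IsRotationExtension f N φ) {t : ℝ} (ht : t ∈ Ioc (0 : ℝ) 1) :
    ∃ n : ℤ, N * Function.leftLim f t = N * t + φ + n := by
  obtain ⟨x, hx, hx'⟩ := ((hf.eventually_leftLim ht).and (eventually_sub_mem_Ico ht)).exists
  obtain ⟨n, hn⟩ := hf.semiconj _ hx'
  exact ⟨n, by rw [hx] at hn; linarith⟩

theorem leftLim_iterate_semiconj (hf : IsRotationExtension f N φ) {t : ℝ}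
    (ht : t ∈ Ioc (0 : ℝ) 1) (k : ℕ) :
    ∃ n : ℤ, N * (Function.leftLim f)^[k] t = N * t + k * φ + n := by
  induction k with
  | zero => exact ⟨0, by simp⟩
  | succ k ih =>
    obtain ⟨n, hn⟩ := ih
    obtain ⟨m, hm⟩ := hf.leftLim_semiconj (hf.leftLim_iterate_mem ht k)
    refine ⟨n + m, ?_⟩
    rw [Function.iterate_succ_apply', hm]
    push_cast
    linarith

theorem eventually_leftLim_sub (hf : IsRotationExtension f N φ) {t : ℝ} (ht : t ∈ Ioc (0 : ℝ) 1) :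
    ∀ᶠ x in 𝓝[>] (0 : ℝ), Function.leftLim f (t - x) = Function.leftLim f t - x := by
  obtain ⟨ε, hε, h⟩ := eventually_nhdsGT_zero_iff.1 (hf.eventually_leftLim ht)
  refine eventually_nhdsGT_zero_iff.2 ⟨ε, hε, fun x h0 h1 => leftLim_eq_of_eventually ?_⟩
  refine eventually_nhdsGT_zero_iff.2 ⟨ε - x, by linarith, fun y hy0 hy1 => ?_⟩
  rw [sub_sub, h _ (by linarith) (by linarith), sub_sub]

theorem eventually_leftLim_add (hf : IsRotationExtension f N φ) {t : ℝ} (ht : t ∈ Ico (0 : ℝ) 1) :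
    ∀ᶠ x in 𝓝[>] (0 : ℝ), Function.leftLim f (t + x) = f t + x := by
  obtain ⟨ε, hε, h⟩ := eventually_nhdsGT_zero_iff.1 (hf.right t ht)
  refine eventually_nhdsGT_zero_iff.2 ⟨ε, hε, fun x h0 h1 => leftLim_eq_of_eventually ?_⟩
  refine eventually_nhdsGT_zero_iff.2 ⟨x, h0, fun y hy0 hy1 => ?_⟩
  rw [add_sub_assoc, h _ (by linarith) (by linarith), add_sub_assoc]

end IsRotationExtension

theorem one_mem_doubledPoints (f : ℝ → ℝ) : (1 : ℝ) ∈ doubledPoints f :=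
  ⟨right_mem_Ioc.2 one_pos, 1, Or.inl rfl, 0, 0, rfl⟩

theorem leftLim_eq_of_notMem_doubledPoints {f : ℝ → ℝ} {t : ℝ} (ht : t ∈ Ioo (0 : ℝ) 1)
    (h : t ∉ doubledPoints f) : Function.leftLim f t = f t := by
  have hc : ContinuousAt f t := by
    by_contra hc
    exact h ⟨⟨ht.1, ht.2.le⟩, t, Or.inr ⟨ht, hc⟩, 0, 0, rfl⟩
  exact leftLim_eq_of_tendsto (hc.tendsto.mono_left nhdsWithin_le_nhds)

/-- Doubled points are closed under images, so that the extension maps the split interval to itself,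
and under preimages, as its continuity at undoubled points requires. -/
theorem IsRotationExtension.leftLim_mem_doubledPoints_iff {f : ℝ → ℝ} {N : ℕ} {φ : ℝ}
    (hf : IsRotationExtension f N φ) {t : ℝ} (ht : t ∈ Ioc (0 : ℝ) 1) :
    Function.leftLim f t ∈ doubledPoints f ↔ t ∈ doubledPoints f := by
  constructor
  · rintro ⟨-, d, hd, m, n, h⟩
    exact ⟨ht, d, hd, m + 1, n, h⟩
  · rintro ⟨-, d, hd, m, n, h⟩
    refine ⟨hf.leftLim_mem ht, d, hd, m, n + 1, ?_⟩
    rw [← Function.iterate_succ_apply, Function.iterate_succ_apply', h,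
      Function.iterate_succ_apply']

/-! ### The split interval -/

namespace SplitInterval

variable {f : ℝ → ℝ}

/-- The position of a point of the split interval. -/
def pos (x : SplitInterval f) : ℝ := (ofLex x.1).1

/-- The side of a point of the split interval: `true` for points of `[0, 1)`. -/
def side (x : SplitInterval f) : Bool := (ofLex x.1).2

/-- The point `t` of the split interval. -/
def right {t : ℝ} (ht : t ∈ Ico (0 : ℝ) 1) : SplitInterval f := ⟨toLex (t, true), Or.inl ⟨rfl, ht⟩⟩

/-- The point `t⁻` of the split interval. -/
def left {t : ℝ} (ht : t ∈ doubledPoints f) : SplitInterval f :=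
  ⟨toLex (t, false), Or.inr ⟨rfl, ht⟩⟩

instance : OrderTopology (SplitInterval f) := ⟨rfl⟩

instance : Nonempty (SplitInterval f) := ⟨right (t := 0) ⟨le_rfl, one_pos⟩⟩

theorem eq_right_or_eq_left (x : SplitInterval f) :
    (∃ (t : ℝ) (ht : t ∈ Ico (0 : ℝ) 1), x = right ht) ∨
      ∃ (t : ℝ) (ht : t ∈ doubledPoints f), x = left ht := by
  obtain ⟨⟨t, s⟩, ⟨h', h⟩ | ⟨h', h⟩⟩ := x
  · obtain rfl : s = true := h'
    exact Or.inl ⟨t, h, rfl⟩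
  · obtain rfl : s = false := h'
    exact Or.inr ⟨t, h, rfl⟩

theorem lt_iff {x y : SplitInterval f} :
    x < y ↔ x.pos < y.pos ∨ x.pos = y.pos ∧ x.side < y.side :=
  Prod.Lex.lt_iff (x := x.1) (y := y.1)

theorem le_iff {x y : SplitInterval f} :
    x ≤ y ↔ x.pos < y.pos ∨ x.pos = y.pos ∧ x.side ≤ y.side :=
  Prod.Lex.le_iff (x := x.1) (y := y.1)

theorem pos_mono {x y : SplitInterval f} (h : x ≤ y) : x.pos ≤ y.pos := by
  rcases le_iff.1 h with h | h
  · exact h.le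
  · exact h.1.le

theorem ext {x y : SplitInterval f} (h : x.pos = y.pos) (h' : x.side = y.side) : x = y :=
  Subtype.ext (Prod.ext h h')

theorem pos_mem (x : SplitInterval f) : x.pos ∈ Icc (0 : ℝ) 1 := by
  obtain ⟨t, ht, rfl⟩ | ⟨t, ht, rfl⟩ := x.eq_right_or_eq_left
  · exact ⟨ht.1, ht.2.le⟩
  · exact ⟨ht.1.1.le, ht.1.2⟩

/-- The point `0` is the least point of the split interval. -/
theorem right_zero_le (y : SplitInterval f) : right (t := 0) ⟨le_rfl, one_pos⟩ ≤ y := by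
  obtain ⟨t, ht, rfl⟩ | ⟨t, ht, rfl⟩ := y.eq_right_or_eq_left
  · exact le_iff.2 (ht.1.lt_or_eq.imp id fun h => ⟨h, le_rfl⟩)
  · exact le_iff.2 (Or.inl ht.1.1)

theorem eq_right_of_notMem {x : SplitInterval f} (h : x.pos ∉ doubledPoints f) :
    ∃ hx : x.pos ∈ Ico (0 : ℝ) 1, x = right hx := by
  obtain ⟨t, ht, rfl⟩ | ⟨t, ht, rfl⟩ := x.eq_right_or_eq_left
  · exact ⟨ht, rfl⟩
  · exact (h ht).elim

/-- Let `t` be the supremum of the positions. The least upper bound is the point `t` if that belongs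
to `S`, otherwise `t⁻` if `t` is doubled, and otherwise the undoubled point `t`, where `t < 1`
because `1` is doubled. -/
theorem exists_isLUB (S : Set (SplitInterval f)) : ∃ c, IsLUB S c := by
  rcases S.eq_empty_or_nonempty with rfl | ⟨x₀, hx₀⟩
  · refine ⟨right (t := 0) ⟨le_rfl, one_pos⟩, by simp, fun y _ => y.right_zero_le⟩
  set t := sSup (pos '' S) with ht
  have hbdd : BddAbove (pos '' S) := ⟨1, by rintro _ ⟨x, -, rfl⟩; exact x.pos_mem.2⟩
  have hle : ∀ x ∈ S, x.pos ≤ t := fun x hx => le_csSup hbdd ⟨x, hx, rfl⟩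
  have hub : ∀ y ∈ upperBounds S, t ≤ y.pos := fun y hy => by
    refine csSup_le ⟨_, x₀, hx₀, rfl⟩ ?_
    rintro _ ⟨x, hx, rfl⟩
    exact pos_mono (hy hx)
  have ht0 : 0 ≤ t := x₀.pos_mem.1.trans (hle x₀ hx₀)
  have ht1 : t ≤ 1 := csSup_le ⟨_, x₀, hx₀, rfl⟩ (by rintro _ ⟨x, -, rfl⟩; exact x.pos_mem.2)
  by_cases h : ∃ ht : t ∈ Ico (0 : ℝ) 1, right ht ∈ S
  · obtain ⟨ht, hS⟩ := h
    refine ⟨right ht, fun x hx => le_iff.2 ?_, fun y hy => hy hS⟩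
    exact (hle x hx).lt_or_eq.imp id fun h => ⟨h, le_top⟩
  by_cases hD : t ∈ doubledPoints f
  · refine ⟨left hD, fun x hx => le_iff.2 ?_, fun y hy => le_iff.2 ?_⟩
    · refine (hle x hx).lt_or_eq.imp id fun hxt => ⟨hxt, ?_⟩
      obtain ⟨s, hs, rfl⟩ | ⟨s, hs, rfl⟩ := x.eq_right_or_eq_left
      · obtain rfl : s = t := hxt
        exact (h ⟨hs, hx⟩).elim
      · exact le_rfl
    · exact (hub y hy).lt_or_eq.imp id fun h => ⟨h, bot_le⟩
  · have ht' : t ∈ Ico (0 : ℝ) 1 :=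
      ⟨ht0, ht1.lt_of_ne fun h => hD (h ▸ one_mem_doubledPoints f)⟩
    refine ⟨right ht', fun x hx => le_iff.2 ?_, fun y hy => le_iff.2 ?_⟩
    · exact (hle x hx).lt_or_eq.imp id fun h => ⟨h, le_top⟩
    · refine (hub y hy).lt_or_eq.imp id fun hty => ⟨hty, ?_⟩
      obtain ⟨_, hy'⟩ := eq_right_of_notMem (x := y) (fun h => hD (by rwa [← hty] at h))
      rw [hy']
      exact le_rfl

instance : CompactSpace (SplitInterval f) := by
  refine ⟨isCompact_iff_ultrafilter_le_nhds.2 fun U _ => ?_⟩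
  -- An ultrafilter converges to the supremum of the points whose upper rays it contains.
  obtain ⟨c, hc⟩ := exists_isLUB {a : SplitInterval f | Ici a ∈ U}
  refine ⟨c, mem_univ c, tendsto_id'.1 (tendsto_order.2 ⟨fun a ha => ?_, fun b hb => ?_⟩)⟩
  · obtain ⟨a', ha', h⟩ := (lt_isLUB_iff hc).1 ha
    exact mem_of_superset ha' fun x hx => h.trans_le hx
  · have : Ici b ∉ U := fun h => (hc.1 h).not_gt hb
    rw [← Ultrafilter.compl_mem_iff_notMem, compl_Ici] at this
    exact this

theorem eventually_pos_lt {x : SplitInterval f} {c : ℝ} (h : x.pos < c) :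
    ∀ᶠ y in 𝓝 x, y.pos < c := by
  rcases x.pos_mem.2.lt_or_eq with h1 | h1
  · obtain ⟨s, hs, hs'⟩ := exists_between (lt_min h h1)
    have hs1 : s ∈ Ico (0 : ℝ) 1 := ⟨x.pos_mem.1.trans hs.le, hs'.trans_le (min_le_right _ _)⟩
    have : x < right hs1 := lt_iff.2 (Or.inl hs)
    exact (eventually_lt_nhds this).mono fun y hy =>
      (pos_mono hy.le).trans_lt (hs'.trans_le (min_le_left _ _))
  · exact Eventually.of_forall fun y => y.pos_mem.2.trans_lt (h1 ▸ h)

theorem eventually_lt_pos {x : SplitInterval f} {c : ℝ} (h : c < x.pos) :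
    ∀ᶠ y in 𝓝 x, c < y.pos := by
  rcases x.pos_mem.1.lt_or_eq with h1 | h1
  · obtain ⟨s, hs, hs'⟩ := exists_between (max_lt h h1)
    have hs1 : s ∈ Ico (0 : ℝ) 1 := ⟨(le_max_right _ _).trans hs.le, hs'.trans_le x.pos_mem.2⟩
    have : right hs1 < x := lt_iff.2 (Or.inl hs')
    exact (eventually_gt_nhds this).mono fun y hy =>
      ((le_max_left _ _).trans_lt hs).trans_le (pos_mono hy.le)
  · exact Eventually.of_forall fun y => (h1 ▸ h).trans_le y.pos_mem.1

/-- A doubled point `t` has the immediate predecessor `t⁻`, and `0` is least, so the upper ray from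
`t` is a neighbourhood of `t`. -/
theorem eventually_right_le {t : ℝ} (ht : t ∈ Ico (0 : ℝ) 1) (h : t = 0 ∨ t ∈ doubledPoints f) :
    ∀ᶠ y in 𝓝 (right ht : SplitInterval f), right ht ≤ y := by
  rcases h with rfl | h
  · exact Eventually.of_forall right_zero_le
  · have : left h < right ht := lt_iff.2 (Or.inr ⟨rfl, Bool.false_lt_true⟩)
    refine (eventually_gt_nhds this).mono fun y hy => le_iff.2 ?_
    refine (lt_iff.1 hy).imp id fun hy' => ⟨hy'.1, ?_⟩
    exact Bool.eq_true_of_true_le (Bool.lt_iff.1 hy'.2).2.ge ▸ le_rfl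

theorem eventually_le_left {t : ℝ} (ht : t ∈ doubledPoints f) :
    ∀ᶠ y in 𝓝 (left ht : SplitInterval f), y ≤ left ht := by
  rcases ht.1.2.lt_or_eq with h | rfl
  · have : left ht < right ⟨ht.1.1.le, h⟩ := lt_iff.2 (Or.inr ⟨rfl, Bool.false_lt_true⟩)
    refine (eventually_lt_nhds this).mono fun y hy => le_iff.2 ?_
    refine (lt_iff.1 hy).imp id fun hy' => ⟨hy'.1, ?_⟩
    exact (Bool.lt_iff.1 hy'.2).1.le
  · refine Eventually.of_forall fun y => le_iff.2 ?_
    obtain ⟨s, hs, rfl⟩ | ⟨s, hs, rfl⟩ := y.eq_right_or_eq_left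
    · exact Or.inl hs.2
    · exact hs.1.2.lt_or_eq.imp id fun h => ⟨h, le_rfl⟩

end SplitInterval

/-! ### Continuity of the extension and existence of minimal sets -/

namespace IsRotationExtension

open SplitInterval

variable {f : ℝ → ℝ} {N : ℕ} {φ : ℝ}

/-- The extension of `f` to the split interval, as a self-map of the split interval. -/
def splitSelfMap (hf : IsRotationExtension f N φ) (x : SplitInterval f) : SplitInterval f :=
  ⟨splitMap f x.1, by
    obtain ⟨t, ht, rfl⟩ | ⟨t, ht, rfl⟩ := x.eq_right_or_eq_left
    · exact Or.inl ⟨rfl, hf.mapsTo t ht⟩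
    · exact Or.inr ⟨rfl, (hf.leftLim_mem_doubledPoints_iff ht.1).2 ht⟩⟩

theorem side_splitSelfMap (hf : IsRotationExtension f N φ) (x : SplitInterval f) :
    (hf.splitSelfMap x).side = x.side := by
  obtain ⟨t, ht, rfl⟩ | ⟨t, ht, rfl⟩ := x.eq_right_or_eq_left <;> rfl

theorem val_iterate_splitSelfMap (hf : IsRotationExtension f N φ) (n : ℕ) (x : SplitInterval f) :
    (hf.splitSelfMap^[n] x).val = (splitMap f)^[n] x.val := by
  induction n with
  | zero => rfl
  | succ n ih => rw [Function.iterate_succ_apply', Function.iterate_succ_apply', ← ih]; rfl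

theorem exists_pos_splitSelfMap_right (hf : IsRotationExtension f N φ) {t : ℝ}
    (ht : t ∈ Ico (0 : ℝ) 1) : ∃ ε > 0, ∀ y : SplitInterval f, t < y.pos → y.pos < t + ε →
      (hf.splitSelfMap y).pos = f t + (y.pos - t) := by
  obtain ⟨ε, hε, h⟩ := eventually_nhdsGT_zero_iff.1
    ((hf.right t ht).and (hf.eventually_leftLim_add ht))
  refine ⟨ε, hε, fun y h1 h2 => ?_⟩
  have h' := h (y.pos - t) (by linarith) (by linarith)
  rw [add_sub_cancel] at h'
  obtain ⟨s, hs, rfl⟩ | ⟨s, hs, rfl⟩ := y.eq_right_or_eq_left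
  exacts [h'.1, h'.2]

theorem exists_pos_splitSelfMap_left (hf : IsRotationExtension f N φ) {t : ℝ}
    (ht : t ∈ Ioc (0 : ℝ) 1) : ∃ ε > 0, ∀ y : SplitInterval f, t - ε < y.pos → y.pos < t →
      (hf.splitSelfMap y).pos = Function.leftLim f t - (t - y.pos) := by
  obtain ⟨ε, hε, h⟩ := eventually_nhdsGT_zero_iff.1
    ((hf.eventually_leftLim ht).and (hf.eventually_leftLim_sub ht))
  refine ⟨ε, hε, fun y h1 h2 => ?_⟩
  have h' := h (t - y.pos) (by linarith) (by linarith)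
  rw [sub_sub_cancel] at h'
  obtain ⟨s, hs, rfl⟩ | ⟨s, hs, rfl⟩ := y.eq_right_or_eq_left
  exacts [h'.1, h'.2]

theorem continuous_splitSelfMap (hf : IsRotationExtension f N φ) :
    Continuous hf.splitSelfMap := by
  refine continuous_iff_continuousAt.2 fun x => tendsto_order.2 ?_
  obtain ⟨t, ht, rfl⟩ | ⟨t, ht, rfl⟩ := x.eq_right_or_eq_left
  · obtain ⟨ε, hε, hr⟩ := hf.exists_pos_splitSelfMap_right ht
    have hub : ∀ b > hf.splitSelfMap (SplitInterval.right ht), f t < b.pos := fun b hb =>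
      (lt_iff.1 hb).elim id fun h => (not_top_lt h.2).elim
    have hlt : ∀ ε' > 0, ∀ᶠ y in 𝓝 (SplitInterval.right ht : SplitInterval f), y.pos < t + ε' :=
      fun ε' h => eventually_pos_lt (show t < t + ε' by linarith)
    by_cases hD : t = 0 ∨ t ∈ doubledPoints f
    · have key : ∀ᶠ y in 𝓝 (SplitInterval.right ht : SplitInterval f),
          y = SplitInterval.right ht ∨
            (t < y.pos ∧ (hf.splitSelfMap y).pos = f t + (y.pos - t)) := by
        filter_upwards [eventually_right_le ht hD, hlt ε hε] with y h1 h2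
        refine h1.eq_or_lt.imp Eq.symm fun h => ?_
        have : t < y.pos := (lt_iff.1 h).elim id fun h => (not_top_lt h.2).elim
        exact ⟨this, hr y this h2⟩
      refine ⟨fun a ha => key.mono fun y hy => ?_, fun b hb => ?_⟩
      · rcases hy with rfl | ⟨h1, h2⟩
        · exact ha
        · exact ha.trans (lt_iff.2 (Or.inl (show f t < _ by linarith)))
      · filter_upwards [key, hlt _ (sub_pos.2 (hub b hb))] with y hy h3
        rcases hy with rfl | ⟨h1, h2⟩
        · exact hb
        · exact lt_iff.2 (Or.inl (by linarith))
    · obtain ⟨h0, hD⟩ := not_or.1 hD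
      have ht0 : 0 < t := ht.1.lt_of_ne (Ne.symm h0)
      have hlim := leftLim_eq_of_notMem_doubledPoints ⟨ht0, ht.2⟩ hD
      obtain ⟨ε', hε', hl⟩ := hf.exists_pos_splitSelfMap_left ⟨ht0, ht.2.le⟩
      have hgt : ∀ ε' > 0, ∀ᶠ y in 𝓝 (SplitInterval.right ht : SplitInterval f), t - ε' < y.pos :=
        fun ε' h => eventually_lt_pos (show t - ε' < t by linarith)
      have key : ∀ᶠ y in 𝓝 (SplitInterval.right ht : SplitInterval f),
          (hf.splitSelfMap y).pos = f t + (y.pos - t) := by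
        filter_upwards [hlt ε hε, hgt ε' hε'] with y h1 h2
        rcases lt_trichotomy y.pos t with h | h | h
        · rw [hl y h2 h, hlim]
          ring
        · obtain ⟨_, h'⟩ := eq_right_of_notMem (x := y) (by rwa [h])
          rw [h, sub_self, add_zero, h']
          exact congrArg f h
        · exact hr y h h1
      -- The danger is `a = (f t)⁻`. Then `f t`, which is also the left limit at `t`, would be
      -- doubled, hence so would its preimage `t`.
      have hlb : ∀ a < hf.splitSelfMap (SplitInterval.right ht), a.pos < f t := fun a ha => by
        refine (lt_iff.1 ha).elim id fun h => ?_
        obtain ⟨_, h'⟩ := eq_right_of_notMem (x := a) fun hmem =>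
          hD ((hf.leftLim_mem_doubledPoints_iff ⟨ht0, ht.2.le⟩).1
            (by rwa [hlim, ← show _ = f t from h.1]))
        rw [h'] at h
        exact (lt_irrefl _ h.2).elim
      refine ⟨fun a ha => ?_, fun b hb => ?_⟩
      · filter_upwards [key, hgt _ (sub_pos.2 (hlb a ha))] with y h1 h2
        exact lt_iff.2 (Or.inl (by linarith))
      · filter_upwards [key, hlt _ (sub_pos.2 (hub b hb))] with y h1 h2
        exact lt_iff.2 (Or.inl (by linarith))
  · obtain ⟨ε, hε, hl⟩ := hf.exists_pos_splitSelfMap_left ht.1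
    have hlb : ∀ a < hf.splitSelfMap (SplitInterval.left ht), a.pos < Function.leftLim f t :=
      fun a ha => (lt_iff.1 ha).elim id fun h => (not_lt_bot h.2).elim
    have hgt : ∀ ε' > 0, ∀ᶠ y in 𝓝 (SplitInterval.left ht), t - ε' < y.pos :=
      fun ε' h => eventually_lt_pos (show t - ε' < t by linarith)
    have key : ∀ᶠ y in 𝓝 (SplitInterval.left ht), y = SplitInterval.left ht ∨
        (y.pos < t ∧ (hf.splitSelfMap y).pos = Function.leftLim f t - (t - y.pos)) := by
      filter_upwards [eventually_le_left ht, hgt ε hε] with y h1 h2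
      refine h1.eq_or_lt.imp id fun h => ?_
      have : y.pos < t := (lt_iff.1 h).elim id fun h => (not_lt_bot h.2).elim
      exact ⟨this, hl y h2 this⟩
    refine ⟨fun a ha => ?_, fun b hb => key.mono fun y hy => ?_⟩
    · filter_upwards [key, hgt _ (sub_pos.2 (hlb a ha))] with y hy h3
      rcases hy with rfl | ⟨h1, h2⟩
      · exact ha
      · exact lt_iff.2 (Or.inl (by linarith))
    · rcases hy with rfl | ⟨h1, h2⟩
      · exact hb
      · exact (lt_iff.2 (Or.inl (show _ < Function.leftLim f t by linarith))).trans hb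

theorem splitMap_image_eq_iff (hf : IsRotationExtension f N φ) (K : Set (SplitInterval f)) :
    splitMap f '' (Subtype.val '' K) = Subtype.val '' K ↔ hf.splitSelfMap '' K = K := by
  have h : splitMap f '' (Subtype.val '' K) = Subtype.val '' (hf.splitSelfMap '' K) := by
    ext z
    constructor <;> rintro ⟨_, ⟨x, hx, rfl⟩, rfl⟩ <;> exact ⟨_, ⟨x, hx, rfl⟩, rfl⟩
  rw [h]
  exact Subtype.val_injective.image_injective.eq_iff

theorem isSplitMinimalComponent_iff (hf : IsRotationExtension f N φ)
    (K : Set (SplitInterval f)) : IsSplitMinimalComponent f K ↔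
      K.Nonempty ∧ IsClosed K ∧ hf.splitSelfMap '' K = K ∧
        ∀ x ∈ K, K ⊆ closure (range fun n : ℕ => hf.splitSelfMap^[n] x) := by
  have h : ∀ x : SplitInterval f, {y : SplitInterval f | ∃ n : ℕ, y.val = (splitMap f)^[n] x.val} =
      range fun n : ℕ => hf.splitSelfMap^[n] x := fun x => by
    ext y
    refine exists_congr fun n => ?_
    rw [← hf.val_iterate_splitSelfMap]
    exact Subtype.val_injective.eq_iff.trans eq_comm
  rw [IsSplitMinimalComponent, hf.splitMap_image_eq_iff]
  simp only [h]

theorem exists_isMinimalComponentOn (hf : IsRotationExtension f N φ) :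
    ∃ J, IsMinimalComponentOn f J := by
  obtain ⟨K, hK⟩ := exists_minimal_set hf.continuous_splitSelfMap
  exact ⟨_, K, (hf.isSplitMinimalComponent_iff K).2 hK, rfl⟩

end IsRotationExtension

/-! ### Traces on `[0, 1)` and finiteness of the minimal components -/

open SplitInterval

/-- The trace on `[0, 1)` of a subset of the split interval. -/
def trace {f : ℝ → ℝ} (K : Set (SplitInterval f)) : Set ℝ := {t | ∃ x ∈ K, x.val = toLex (t, true)}

theorem mem_trace_iff {f : ℝ → ℝ} {K : Set (SplitInterval f)} {t : ℝ} :
    t ∈ trace K ↔ ∃ ht : t ∈ Ico (0 : ℝ) 1, SplitInterval.right ht ∈ K := by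
  constructor
  · rintro ⟨x, hx, h⟩
    obtain ⟨s, hs, rfl⟩ | ⟨s, hs, rfl⟩ := x.eq_right_or_eq_left
    · obtain rfl : s = t := congrArg Prod.fst h
      exact ⟨hs, hx⟩
    · exact (Bool.false_ne_true (congrArg Prod.snd h)).elim
  · rintro ⟨ht, h⟩
    exact ⟨_, h, rfl⟩

theorem exists_gap_of_notMem_trace {f : ℝ → ℝ} {K : Set (SplitInterval f)} (hK : IsClosed K)
    {t : ℝ} (ht : t ∈ Ico (0 : ℝ) 1) (htK : t ∉ trace K) :
    ∃ ε > 0, ∀ x ∈ K, t < x.pos → t + ε ≤ x.pos := by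
  have hmem : Kᶜ ∈ 𝓝 (SplitInterval.right ht : SplitInterval f) :=
    hK.isOpen_compl.mem_nhds fun h => htK (mem_trace_iff.2 ⟨ht, h⟩)
  obtain ⟨u, hu, h⟩ := exists_Ico_subset_of_mem_nhds hmem
    ⟨SplitInterval.left (one_mem_doubledPoints f), lt_iff.2 (Or.inl ht.2)⟩
  have hu' : t < u.pos := (lt_iff.1 hu).elim id fun h => (not_top_lt h.2).elim
  refine ⟨u.pos - t, sub_pos.2 hu', fun x hx htx => le_of_not_gt fun hlt => ?_⟩
  exact h ⟨le_iff.2 (Or.inl htx), lt_iff.2 (Or.inl (by linarith))⟩ hx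

/-- Otherwise `K` consists of points `t⁻` only and has a gap to the right of every `k / N`. The
orbit of any `t⁻` in `K` lies over a dense rotation orbit, so it enters one of these gaps. -/
theorem trace_nonempty {f : ℝ → ℝ} {N : ℕ} {φ : ℝ} (hf : IsRotationExtension f N φ)
    {K : Set (SplitInterval f)} (hne : K.Nonempty) (hK : IsClosed K)
    (himage : hf.splitSelfMap '' K = K) : (trace K).Nonempty := by
  have hN : (0 : ℝ) < N := Nat.cast_pos.2 hf.pos
  by_contra h
  rw [not_nonempty_iff_eq_empty] at h
  have hgap : ∀ᶠ ε in 𝓝[>] (0 : ℝ), ∀ k : Fin N, ∀ x ∈ K, x.pos ≠ (k : ℕ) / N + ε := by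
    refine eventually_all.2 fun k => ?_
    have hk : ((k : ℕ) / N : ℝ) ∈ Ico (0 : ℝ) 1 :=
      ⟨by positivity, (div_lt_one hN).2 (Nat.cast_lt.2 k.2)⟩
    obtain ⟨ε, hε, h'⟩ := exists_gap_of_notMem_trace hK hk (h ▸ notMem_empty _)
    exact eventually_nhdsGT_zero_iff.2 ⟨ε, hε, fun y h0 h1 x hx hxy =>
      absurd (h' x hx (by linarith)) (by linarith)⟩
  obtain ⟨ε, hε, hgap⟩ := eventually_nhdsGT_zero_iff.1 hgap
  obtain ⟨x, hx⟩ := hne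
  obtain ⟨t, ht, rfl⟩ | ⟨t, ht, rfl⟩ := x.eq_right_or_eq_left
  · exact (h ▸ mem_trace_iff.2 ⟨ht, hx⟩ : t ∈ (∅ : Set ℝ))
  -- The bound `N * ε` becomes the gap length after division by `N`; the bound `1` ensures that the
  -- integer part of `N * s` is one of `0, …, N - 1`.
  obtain ⟨n, m, h0, h1⟩ := exists_nat_mul_add_int_mem_Ioo hf.irrational (N * t)
    (lt_min (mul_pos hN hε) one_pos)
  obtain ⟨q, hq⟩ := hf.leftLim_iterate_semiconj ht.1 n
  obtain ⟨hs0, hs1⟩ := hf.leftLim_iterate_mem ht.1 n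
  have hmem : ∀ n : ℕ, ∃ x ∈ K, x.pos = (Function.leftLim f)^[n] t ∧ x.side = false := by
    intro n
    induction n with
    | zero => exact ⟨_, hx, rfl, rfl⟩
    | succ n ih =>
      obtain ⟨x, hx, hpos, hside⟩ := ih
      refine ⟨_, himage ▸ mem_image_of_mem _ hx, ?_, (hf.side_splitSelfMap x).trans hside⟩
      rw [Function.iterate_succ_apply', ← hpos]
      obtain ⟨s, hs, rfl⟩ | ⟨s, hs, rfl⟩ := x.eq_right_or_eq_left
      · exact (Bool.false_ne_true hside.symm).elim
      · rfl
  obtain ⟨x, hxK, hxpos, -⟩ := hmem n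
  set s := (Function.leftLim f)^[n] t
  set y := N * t + n * φ + m with hy
  obtain ⟨hy1, hy2⟩ := lt_min_iff.1 h1
  have hsy : N * s = y + (q - m : ℤ) := by rw [hq, hy]; push_cast; ring
  have hNs : 0 < N * s := mul_pos hN hs0
  have hNs' : N * s ≤ N := by nlinarith
  have hj0 : 0 ≤ q - m := by
    have : ((-1 : ℤ) : ℝ) < (q - m : ℤ) := by push_cast at hsy ⊢; linarith
    have := Int.cast_lt.1 this
    omega
  have hjN : q - m < N := by
    have : ((q - m : ℤ) : ℝ) < ((N : ℤ) : ℝ) := by push_cast at hsy ⊢; linarith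
    exact Int.cast_lt.1 this
  obtain ⟨j, hj⟩ := Int.eq_ofNat_of_zero_le hj0
  have hjN' : j < N := by omega
  refine hgap (y / N) (div_pos h0 hN) ((div_lt_iff₀ hN).2 (by linarith)) ⟨j, hjN'⟩ x hxK ?_
  rw [hxpos, ← add_div, eq_div_iff hN.ne', mul_comm, hsy, hj]
  push_cast
  ring

theorem isRightClosedInvariant_trace {f : ℝ → ℝ} {N : ℕ} {φ : ℝ}
    (hf : IsRotationExtension f N φ) {K : Set (SplitInterval f)} (hne : K.Nonempty)
    (hK : IsClosed K) (himage : hf.splitSelfMap '' K = K) :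
    IsRightClosedInvariant f (trace K) where
  subset t ht := (mem_trace_iff.1 ht).1
  nonempty := trace_nonempty hf hne hK himage
  image_eq := by
    ext y
    constructor
    · rintro ⟨t, ht, rfl⟩
      obtain ⟨ht, htK⟩ := mem_trace_iff.1 ht
      exact mem_trace_iff.2 ⟨hf.mapsTo t ht, himage ▸ mem_image_of_mem hf.splitSelfMap htK⟩
    · intro hy
      obtain ⟨hy, hyK⟩ := mem_trace_iff.1 hy
      obtain ⟨x, hx, hxy⟩ := himage.symm ▸ hyK
      obtain ⟨t, ht, rfl⟩ | ⟨t, ht, rfl⟩ := x.eq_right_or_eq_left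
      · exact ⟨t, mem_trace_iff.2 ⟨ht, hx⟩, congrArg pos hxy⟩
      · exact (Bool.false_ne_true (congrArg side hxy)).elim
  right t ht htK := by
    obtain ⟨ε, hε, h⟩ := exists_gap_of_notMem_trace hK ht htK
    refine eventually_nhdsGT_zero_iff.2 ⟨ε, hε, fun x h0 h1 hx => ?_⟩
    obtain ⟨hx', hxK⟩ := mem_trace_iff.1 hx
    have : t + ε ≤ t + x := h _ hxK (show t < t + x by linarith)
    linarith

theorem IsMinimalComponentOn.isRightClosedInvariant {f : ℝ → ℝ} {N : ℕ} {φ : ℝ} {J : Set ℝ}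
    (hJ : IsMinimalComponentOn f J) (hf : IsRotationExtension f N φ) :
    IsRightClosedInvariant f J := by
  obtain ⟨K, hK, rfl⟩ := hJ
  obtain ⟨h1, h2, h3, -⟩ := (hf.isSplitMinimalComponent_iff K).1 hK
  exact isRightClosedInvariant_trace hf h1 h2 h3

/-- Minimal components that have a common point are equal. -/
theorem IsMinimalComponentOn.eq_of_mem {f : ℝ → ℝ} {N : ℕ} {φ : ℝ}
    (hf : IsRotationExtension f N φ) {J J' : Set ℝ} (hJ : IsMinimalComponentOn f J)
    (hJ' : IsMinimalComponentOn f J') {t : ℝ} (ht : t ∈ J) (ht' : t ∈ J') : J = J' := by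
  obtain ⟨K, hK, rfl⟩ := hJ
  obtain ⟨K', hK', rfl⟩ := hJ'
  obtain ⟨_, htK⟩ := mem_trace_iff.1 ht
  obtain ⟨_, htK'⟩ := mem_trace_iff.1 ht'
  rw [hf.isSplitMinimalComponent_iff] at hK hK'
  have hsub : ∀ {L L' : Set (SplitInterval f)} {x : SplitInterval f}, x ∈ L → x ∈ L' →
      (∀ x ∈ L, L ⊆ closure (range fun n : ℕ => hf.splitSelfMap^[n] x)) → IsClosed L' →
      hf.splitSelfMap '' L' = L' → L ⊆ L' := fun {L L' x} hL hL' hmin hcl himage =>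
    (hmin x hL).trans <| closure_minimal
      (range_subset_iff.2 fun n => (mapsTo_iff_image_subset.2 himage.le).iterate n hL') hcl
  rw [(hsub htK htK' hK.2.2.2 hK'.2.1 hK'.2.2.1).antisymm
    (hsub htK' htK hK'.2.2.2 hK.2.1 hK.2.2.1)]

/-- A component is determined by its fibre over `0`: this fibre is nonempty, and components with a
common point coincide. There are finitely many possible fibres. -/
theorem IsRotationExtension.finite_isMinimalComponentOn {f : ℝ → ℝ} {N : ℕ} {φ : ℝ}
    (hf : IsRotationExtension f N φ) : {J | IsMinimalComponentOn f J}.Finite := by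
  refine Set.Finite.of_finite_image (f := fun J => fibre N J 0) ?_ fun J hJ J' hJ' h => ?_
  · refine (fibre_finite hf.pos subset_rfl 0).finite_subsets.subset ?_
    rintro _ ⟨J, hJ, rfl⟩
    exact fun t ht => ⟨(hJ.isRightClosedInvariant hf).subset ht.1, ht.2⟩
  · obtain ⟨t, ht⟩ := (IsMinimalComponentOn.isRightClosedInvariant hJ hf).fibre_nonempty hf 0
    have ht' : t ∈ fibre N J' 0 := (show fibre N J 0 = fibre N J' 0 from h) ▸ ht
    exact IsMinimalComponentOn.eq_of_mem hf hJ hJ' ht.1 ht'.1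

/-! ### Fractional parts near a point -/

theorem eventually_fract_add (a : ℝ) :
    ∀ᶠ x in 𝓝[>] (0 : ℝ), Int.fract (a + x) = Int.fract a + x := by
  refine eventually_nhdsGT_zero_iff.2 ⟨1 - Int.fract a, sub_pos.2 (Int.fract_lt_one a),
    fun x h0 h1 => Int.fract_eq_iff.2 ⟨?_, by linarith, ⌊a⌋, ?_⟩⟩
  · linarith [Int.fract_nonneg a]
  · linarith [Int.floor_add_fract a]

theorem exists_eventually_fract_sub (a : ℝ) :
    ∃ c, ∀ᶠ x in 𝓝[>] (0 : ℝ), Int.fract (a - x) = c - x := by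
  have h1 := Int.le_ceil a
  have h2 := Int.ceil_lt_add_one a
  -- The left limit of the fractional part at `a`: it is `1`, not `0`, when `a` is an integer.
  refine ⟨a - (⌈a⌉ - 1), eventually_nhdsGT_zero_iff.2 ⟨a - (⌈a⌉ - 1), by linarith,
    fun x h0 h1 => Int.fract_eq_iff.2 ⟨by linarith, by linarith, ⌈a⌉ - 1, ?_⟩⟩⟩
  push_cast
  ring

/-! ### The identification of the phase space with the unit interval -/

theorem circle_exp_eq_iff {x : ℝ} {τ : Circle} :
    Circle.exp (2 * Real.pi * x) = τ ↔ ∃ m : ℤ, x = Complex.arg (τ : ℂ) / (2 * Real.pi) + m := by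
  rw [← Circle.exp_arg τ, Circle.exp_eq_exp, Circle.exp_arg]
  refine exists_congr fun m => ?_
  rw [← sub_eq_iff_eq_add, ← sub_eq_iff_eq_add, eq_div_iff Real.two_pi_pos.ne', sub_mul,
    mul_comm x]

section toInterval

variable {𝒜 : Type*} {σ : 𝒜 → List 𝒜} {N : ℕ} (e : Label σ ≃ Fin N)

theorem toInterval_exp (θ : ℝ) (b : Label σ) :
    toInterval e (Circle.exp (2 * Real.pi * θ), b) = (((e b : ℕ) : ℝ) + Int.fract θ) / N := by
  obtain ⟨m, hm⟩ := circle_exp_eq_iff.1 (Eq.refl (Circle.exp (2 * Real.pi * θ)))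
  rw [toInterval]
  conv_rhs => rw [hm, Int.fract_add_intCast]

theorem exists_circle_exp_eq (τ : Circle) :
    ∃ θ ∈ Ico (0 : ℝ) 1, Circle.exp (2 * Real.pi * θ) = τ := by
  refine ⟨Int.fract (Complex.arg (τ : ℂ) / (2 * Real.pi)), ⟨Int.fract_nonneg _, Int.fract_lt_one _⟩,
    circle_exp_eq_iff.2 ⟨-⌊Complex.arg (τ : ℂ) / (2 * Real.pi)⌋, ?_⟩⟩
  push_cast
  rw [Int.fract, sub_eq_add_neg]

theorem toInterval_mem (x : Circle × Label σ) : toInterval e x ∈ Ico (0 : ℝ) 1 := by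
  have hk : (e x.2 : ℕ) + 1 ≤ N := (e x.2).2
  have hk' : ((e x.2 : ℕ) : ℝ) + 1 ≤ N := by exact_mod_cast hk
  have h0 := Int.fract_nonneg (Complex.arg (x.1 : ℂ) / (2 * Real.pi))
  have h1 := Int.fract_lt_one (Complex.arg (x.1 : ℂ) / (2 * Real.pi))
  have hN : (0 : ℝ) < N := by linarith [Nat.cast_nonneg (α := ℝ) (e x.2 : ℕ)]
  refine ⟨by unfold toInterval; positivity, ?_⟩
  rw [toInterval, div_lt_one hN]
  linarith

theorem toInterval_injective : Function.Injective (toInterval e) := by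
  rintro ⟨τ, b⟩ ⟨τ', b'⟩ h
  obtain ⟨θ, hθ, rfl⟩ := exists_circle_exp_eq τ
  obtain ⟨θ', hθ', rfl⟩ := exists_circle_exp_eq τ'
  have hN : (N : ℝ) ≠ 0 := Nat.cast_ne_zero.2 (e b).pos.ne'
  rw [toInterval_exp, toInterval_exp, div_left_inj' hN, Int.fract_eq_self.2 hθ,
    Int.fract_eq_self.2 hθ'] at h
  have hfloor := congrArg Int.floor h
  rw [Int.floor_natCast_add, Int.floor_natCast_add, Int.floor_eq_zero_iff.2 hθ,
    Int.floor_eq_zero_iff.2 hθ'] at hfloor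
  have hb : (e b : ℕ) = e b' := by omega
  rw [hb] at h
  rw [add_left_cancel h, e.injective (Fin.ext hb)]

theorem toInterval_eq {θ : ℝ} {b : Label σ} (h : θ - (e b : ℕ) ∈ Ico (0 : ℝ) 1) :
    toInterval e (Circle.exp (2 * Real.pi * θ), b) = θ / N := by
  have : Int.fract θ = θ - (e b : ℕ) :=
    Int.fract_eq_iff.2 ⟨h.1, h.2, (e b : ℕ), by push_cast; ring⟩
  rw [toInterval_exp, this, add_sub_cancel]

theorem exists_label_of_mem_Ico {t : ℝ} (ht : t ∈ Ico (0 : ℝ) 1) (hN : 0 < N) :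
    ∃ b : Label σ, N * t - (e b : ℕ) ∈ Ico (0 : ℝ) 1 := by
  have hN' : (0 : ℝ) < N := Nat.cast_pos.2 hN
  have h0 : 0 ≤ N * t := mul_nonneg hN'.le ht.1
  have hlt : ⌊N * t⌋₊ < N := (Nat.floor_lt h0).2 (by nlinarith [ht.2])
  refine ⟨e.symm ⟨_, hlt⟩, ?_⟩
  rw [Equiv.apply_symm_apply]
  exact ⟨sub_nonneg.2 (Nat.floor_le h0), by linarith [Nat.lt_floor_add_one (N * t)]⟩

/-- Serves for left germs: a boundary point `k / N` is approached from the left through the circle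
numbered `k - 1`, hence the ceiling minus one. -/
theorem exists_label_of_mem_Ioc {t : ℝ} (ht : t ∈ Ioc (0 : ℝ) 1) (hN : 0 < N) :
    ∃ b : Label σ, N * t - (e b : ℕ) ∈ Ioc (0 : ℝ) 1 := by
  have hN' : (0 : ℝ) < N := Nat.cast_pos.2 hN
  have h0 : 0 < N * t := mul_pos hN' ht.1
  have hpos : 0 < ⌈N * t⌉₊ := Nat.ceil_pos.2 h0
  have hle : ⌈N * t⌉₊ ≤ N := Nat.ceil_le.2 (by nlinarith [ht.2])
  refine ⟨e.symm ⟨⌈N * t⌉₊ - 1, by omega⟩, ?_⟩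
  rw [Equiv.apply_symm_apply, Nat.cast_sub hpos]
  push_cast
  exact ⟨by linarith [Nat.ceil_lt_add_one h0.le], by linarith [Nat.le_ceil (N * t)]⟩

theorem range_toInterval (hN : 0 < N) : range (toInterval e) = Ico 0 1 := by
  refine (range_subset_iff.2 (toInterval_mem e)).antisymm fun t ht => ?_
  obtain ⟨b, hb⟩ := exists_label_of_mem_Ico e ht hN
  exact ⟨_, (toInterval_eq e hb).trans (mul_div_cancel_left₀ _ (Nat.cast_ne_zero.2 hN.ne'))⟩

theorem intervalMap_toInterval (H : Circle × Label σ → Circle × Label σ) (x : Circle × Label σ) :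
    intervalMap e H (toInterval e x) = toInterval e (H x) :=
  (toInterval_injective e).extend_apply _ _ x

end toInterval

/-! ### The skew product as a piecewise translation -/

section SkewProduct

variable {𝒜 : Type*} {σ : 𝒜 → List 𝒜} {β : ℂ} {Γ : 𝒜 → ℂ}

theorem irrational_of_pow_ne_one (hβ₀ : ∀ n : ℕ, 0 < n → (β / (‖β‖ : ℂ)) ^ n ≠ 1) {ρ : Circle}
    (hρ : (ρ : ℂ) = (β / (‖β‖ : ℂ))⁻¹) {φ : ℝ} (hφ : Circle.exp (2 * Real.pi * φ) = ρ) :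
    Irrational φ := by
  rintro ⟨q, rfl⟩
  refine hβ₀ q.den q.den_pos ?_
  -- If `φ` were rational, its denominator would be an exponent making `ρ` a root of unity.
  have h : ρ ^ q.den = 1 := by
    rw [← hφ, ← Circle.exp_natCast_mul, ← Circle.exp_int_mul_two_pi q.num]
    congr 1
    have : (q : ℝ) * q.den = q.num := by exact_mod_cast q.mul_den_eq_num
    rw [← this]
    ring
  have h' := congrArg (fun z : Circle => (z : ℂ)) h
  simp only [Circle.coe_pow, Circle.coe_one, hρ, inv_pow] at h'
  exact inv_eq_one.1 h'

theorem IsSkewProduct.isRotationExtension [Finite 𝒜] (hβ : 1 < ‖β‖)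
    (hβ₀ : ∀ n : ℕ, 0 < n → (β / (‖β‖ : ℂ)) ^ n ≠ 1) (hne : ∀ a, σ a ≠ [])
    (hurp : UniqueRepresentation σ β Γ) {H : Circle × Label σ → Circle × Label σ}
    (hH : IsSkewProduct σ β Γ H) {N : ℕ} (hN : 0 < N) (e : Label σ ≃ Fin N) :
    ∃ φ, IsRotationExtension (intervalMap e H) N φ := by
  have hN' : (0 : ℝ) < N := Nat.cast_pos.2 hN
  obtain ⟨ρ, hρ⟩ := exists_circle_eq hβ
  obtain ⟨φ, -, hφ⟩ := exists_circle_exp_eq ρ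
  have hH' := (isSkewProduct_iff hρ H).1 hH
  -- In the coordinate `N t`, the map rotates by `φ` and replaces the circle number by that of the
  -- new label. Germs of `f` thus reduce to germs of the label and of the fractional part.
  have hmap : ∀ (t : ℝ) (b : Label σ), N * t - (e b : ℕ) ∈ Ico (0 : ℝ) 1 → intervalMap e H t =
      (((e (H (Circle.exp (2 * Real.pi * (N * t)), b)).2 : ℕ) : ℝ) +
        Int.fract (φ + N * t)) / N := by
    intro t b h
    have ht := toInterval_eq e h
    rw [mul_div_cancel_left₀ _ hN'.ne'] at ht
    rw [← toInterval_exp, mul_add, Circle.exp_add, hφ, ← (hH' _ b).1, Prod.mk.eta,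
      ← intervalMap_toInterval, ht]
  have htend : ∀ {c : ℝ}, 0 < c → Tendsto (fun x : ℝ => c * (N * x)) (𝓝[>] 0) (𝓝[>] 0) :=
    fun hc => (tendsto_mul_nhdsGT_zero hc).comp (tendsto_mul_nhdsGT_zero hN')
  refine ⟨φ, hN, irrational_of_pow_ne_one hβ₀ hρ hφ, fun t ht => ?_, fun t ht => ?_,
    fun t ht => ?_, fun t ht => ?_⟩
  · obtain ⟨x, rfl⟩ := (range_toInterval e hN).ge ht
    rw [intervalMap_toInterval]
    exact toInterval_mem e _
  · obtain ⟨b, hb⟩ := exists_label_of_mem_Ico e ht hN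
    have h1 := (htend Real.two_pi_pos).eventually
      (hH' (Circle.exp (2 * Real.pi * (N * t))) b).2.2
    have h2 := (tendsto_mul_nhdsGT_zero hN').eventually (eventually_fract_add (φ + N * t))
    have h3 := (tendsto_mul_nhdsGT_zero hN').eventually (eventually_add_mem_Ico hb)
    filter_upwards [h1, h2, h3] with x hx1 hx2 hx3
    rw [hmap t b hb, hmap (t + x) b (by convert hx3 using 1; ring), mul_add, mul_add,
      Circle.exp_add, hx1, ← add_assoc, hx2]
    field_simp
    ring
  · obtain ⟨b, hb⟩ := exists_label_of_mem_Ioc e ht hN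
    obtain ⟨c, hc⟩ := hH.eventually_left hβ hne hurp (Circle.exp (2 * Real.pi * (N * t))) b
    obtain ⟨d, hd⟩ := exists_eventually_fract_sub (φ + N * t)
    refine ⟨(((e c : ℕ) : ℝ) + d) / N, ?_⟩
    have h1 := (htend Real.two_pi_pos).eventually hc
    have h2 := (tendsto_mul_nhdsGT_zero hN').eventually hd
    have h3 := (tendsto_mul_nhdsGT_zero hN').eventually (eventually_sub_mem_Ico hb)
    filter_upwards [h1, h2, h3] with x hx1 hx2 hx3
    rw [hmap (t - x) b (by convert hx3 using 1; ring),
      show 2 * Real.pi * (N * (t - x)) = 2 * Real.pi * (N * t) + -(2 * Real.pi * (N * x)) by ring,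
      Circle.exp_add, hx1, mul_sub, ← add_sub_assoc, hx2]
    field_simp
    ring
  · obtain ⟨b, hb⟩ := exists_label_of_mem_Ico e ht hN
    refine ⟨(e (H (Circle.exp (2 * Real.pi * (N * t)), b)).2 : ℕ) - ⌊φ + N * t⌋, ?_⟩
    rw [hmap t b hb, mul_div_cancel₀ _ hN'.ne', Int.fract]
    push_cast
    ring

theorem isMinimalComponent_finite_nonempty_isIEM {H : Circle × Label σ → Circle × Label σ} {N : ℕ}
    (e : Label σ ≃ Fin N) {φ : ℝ} (hf : IsRotationExtension (intervalMap e H) N φ) :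
    {K | IsMinimalComponent e H K}.Finite ∧ {K | IsMinimalComponent e H K}.Nonempty ∧
      ∀ K, IsMinimalComponent e H K → ∃ (k : ℕ) (u v d : Fin k → ℝ),
        IsIEM (intervalMap e H) (toInterval e '' K) u v d := by
  refine ⟨?_, ?_, fun K hK =>
    (IsMinimalComponentOn.isRightClosedInvariant hK hf).exists_isIEM hf⟩
  · exact hf.finite_isMinimalComponentOn.preimage (f := image (toInterval e))
      (toInterval_injective e).image_injective.injOn
  · obtain ⟨J, hJ⟩ := hf.exists_isMinimalComponentOn
    refine ⟨toInterval e ⁻¹' J, ?_⟩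
    have h : toInterval e '' (toInterval e ⁻¹' J) = J := image_preimage_eq_of_subset <|
      (hJ.isRightClosedInvariant hf).subset.trans (range_toInterval e hf.pos).ge
    rwa [mem_ofPred_eq, IsMinimalComponent, h]

end SkewProduct

end

end SelfSimilarIEM

/-! ### The main theorem -/

theorem theorem3p1 {𝒜 : Type*} [Fintype 𝒜] [DecidableEq 𝒜]
    (T : ℝ → ℝ) (l r δ : 𝒜 → ℝ) (α : ℝ) (σ : 𝒜 → List 𝒜) (β : ℂ) (Γ : 𝒜 → ℂ)
    (hT : SelfSimilarIEM.IsIEM T (Set.Ico 0 1) l r δ)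
    (hα : SelfSimilarIEM.IsSelfSimilarOn T α)
    (hσ : SelfSimilarIEM.IsAssociatedSubstitution T l r α σ)
    (hΓ : Module.End.HasEigenvector
      (Matrix.toLin' (SelfSimilarIEM.substMatrix σ)) β Γ)
    (hβ : 1 < ‖β‖)
    (hβ₀ : ∀ n : ℕ, 0 < n → (β / (‖β‖ : ℂ)) ^ n ≠ 1)
    (hurp : SelfSimilarIEM.UniqueRepresentation σ β Γ) :
    (∃! H, SelfSimilarIEM.IsSkewProduct σ β Γ H) ∧
    ∀ H, SelfSimilarIEM.IsSkewProduct σ β Γ H →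
      ∀ (N : ℕ) (e : SelfSimilarIEM.Label σ ≃ Fin N),
        {K | SelfSimilarIEM.IsMinimalComponent e H K}.Finite ∧
        {K | SelfSimilarIEM.IsMinimalComponent e H K}.Nonempty ∧
        ∀ K, SelfSimilarIEM.IsMinimalComponent e H K →
          ∃ (k : ℕ) (u v d : Fin k → ℝ),
            SelfSimilarIEM.IsIEM (SelfSimilarIEM.intervalMap e H)
              (SelfSimilarIEM.toInterval e '' K) u v d := by
  -- First return times are positive.
  have hne : ∀ a, σ a ≠ [] := fun a =>
    List.length_pos_iff.1 (hσ a (l a) (Set.left_mem_Ico.2 (hT.lt a))).1.1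
  refine ⟨SelfSimilarIEM.existsUnique_isSkewProduct hβ hne hurp, fun H hH N e => ?_⟩
  -- A nonzero eigenvector forces a letter, hence a label, to exist, which gives `0 < N`.
  obtain ⟨a, -⟩ := Function.ne_iff.1 hΓ.2
  obtain ⟨b, -⟩ := SelfSimilarIEM.Label.exists_isLabelOf hne a
  obtain ⟨φ, hf⟩ := hH.isRotationExtension hβ hβ₀ hne hurp (e b).pos e
  exact SelfSimilarIEM.isMinimalComponent_finite_nonempty_isIEM e hf
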